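/- Let $\mathbb T=(\mathbb R/2\pi\mathbb Z)^3$, let $\alpha,\gamma>0$ and $g\in [L^2(\mathbb T)]^3$. Let $$\mathcal H_\alpha:=\{v\in [H^1(\mathbb T)]^3:\ \operatorname{div}v=0\},\qquad \|v\|_{\mathcal H_\alpha}^2:=\|v\|_{L^2}^2+\alpha\|\nabla v\|_{L^2}^2 ,$$ and let $\bar u_0\in\mathcal H_\alpha$. Consider the damped Bardina--Euler problem on $\mathbb T$, $$\partial_t\bar u-\alpha\,\partial_t\Delta\bar u+(\bar u,\nabla)\bar u+\nabla p+\gamma(\bar u-\alpha\Delta\bar u)=g,\qquad \operatorname{div}\bar u=0,\qquad \bar u|_{t=0}=\bar u_0. \tag{1}$$ A *strong solution* of (1) is a function $\bar u\in C^1([0,\infty);\mathcal H_\alpha)$ with $\bar u(0)=\bar u_0$ such that for every $t\ge 0$ and every smooth divergence-free vector field $\psi$ on $\mathbb T$ $$(\partial_t\bar u,\psi)+\alpha(\nabla\partial_t\bar u,\nabla\psi)+((\bar u,\nabla)\bar u,\psi)+\gamma\big[(\bar u,\psi)+\alpha(\nabla\bar u,\nabla\psi)\big]=(g,\psi),$$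 where $(\cdot,\cdot)$ is the scalar product of $L^2(\mathbb T)$. Let $\Pi$ be the Leray projector onto divergence-free fields. For a smooth vector field $\varphi(t,x)$, divergence free in $x\in\mathbb T$, put $$D_\alpha(\varphi):=\partial_t\varphi-\alpha\,\partial_t\Delta\varphi+\Pi(\varphi,\nabla)\varphi+\gamma(\varphi-\alpha\Delta\varphi)-\Pi g,\qquad e_\alpha(\varphi)(t):=\sup_{0\ne z\in\mathcal H_\alpha}\frac{-((z,\nabla)\varphi(t),z)}{\|z\|_{\mathcal H_\alpha}^2}.$$ A *dissipative solution* of (1) is a function $\bar u:[0,\infty)\to\mathcal H_\alpha$, locally bounded and weakly continuous, with $\bar u(0)=\bar u_0$, such that for every such $\varphi$ and every $t\ge0$ $$\|\bar u(t)-\varphi(t)\|^2_{\mathcal H_\alpha}\le \|\bar u(0)-\varphi(0)\|^2_{\mathcal H_\alpha}e^{-2\int_0^t(\gamma-e_\alpha(\varphi)(s))\,ds}-2\int_0^te^{-2\int_\tau^t(\gamma-e_\alpha(\varphi)(s))\,ds}\big(D_\alpha(\varphi)(\tau),\bar u(\tau)-\varphi(\tau)\big)\,d\tau .$$ Then problem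 (1) has exactly one strong solution $\bar u$; it is a dissipative solution of (1), and every dissipative solution of (1) coincides with $\bar u$ on $[0,\infty)$. In particular, the dissipative solution of (1) is unique. -/

import Mathlib

open MeasureTheory Set
open scoped ContDiff InnerProductSpace Laplacian

noncomputable section

namespace BardinaEuler

/-- Three-dimensional Euclidean space. -/
abbrev E : Type := EuclideanSpace ℝ (Fin 3)

/-- `3 × 3` real matrices with the Frobenius norm. -/
abbrev Mat : Type := EuclideanSpace ℝ (Fin 3 × Fin 3)

/-- The `i`-th coordinate vector. -/
abbrev e (i : Fin 3) : E := EuclideanSpace.single i (1 : ℝ)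

/-- A half-open fundamental cell of the torus `(ℝ / 2πℤ)³`.  Functions on the torus are
`2π`-periodic functions on `ℝ³`; up to null sets they are functions on this cell. -/
def cell : Set E := {x | ∀ i, x i ∈ Ioc (-Real.pi) Real.pi}

/-- Lebesgue measure on the torus. -/
def torusMeasure : Measure E := volume.restrict cell

/-- `L²` vector fields on the torus. -/
abbrev L2 : Type := Lp E 2 torusMeasure

/-- `L²` matrix fields on the torus. -/
abbrev L2Mat : Type := Lp Mat 2 torusMeasure

/-- `f` is `2π`-periodic in each coordinate, that is, `f` is a function on the torus. -/
def IsPeriodic {F : Type*} (f : E → F) : Prop :=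
  ∀ i : Fin 3, Function.Periodic f ((2 * Real.pi) • e i)

theorem cell_subset : cell ⊆ Metric.closedBall (0 : E) (2 * Real.pi) := by
  intro x hx
  have hpi := Real.pi_pos
  rw [mem_closedBall_zero_iff, EuclideanSpace.norm_eq]
  apply Real.sqrt_le_iff.2
  refine ⟨by positivity, ?_⟩
  have h : ∀ i, ‖x i‖ ^ 2 ≤ Real.pi ^ 2 := fun i => by
    rw [Real.norm_eq_abs, sq_abs]
    have := hx i
    exact sq_le_sq' this.1.le this.2
  calc ∑ i, ‖x i‖ ^ 2 ≤ ∑ _i : Fin 3, Real.pi ^ 2 := Finset.sum_le_sum fun i _ => h i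
    _ ≤ (2 * Real.pi) ^ 2 := by simp; nlinarith

theorem memLp_of_continuous {F : Type*} [NormedAddCommGroup F] {f : E → F}
    (hf : Continuous f) : MemLp f 2 torusMeasure := by
  have hfin : IsFiniteMeasure torusMeasure := by
    refine ⟨?_⟩
    rw [torusMeasure, Measure.restrict_apply_univ]
    exact (measure_mono cell_subset).trans_lt
      (isCompact_closedBall (0 : E) (2 * Real.pi)).measure_lt_top
  have hmeas : MeasurableSet cell := by
    have : cell = ⋂ i, (fun x : E => x i) ⁻¹' Ioc (-Real.pi) Real.pi := by
      ext x; simp [cell]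
    rw [this]
    exact MeasurableSet.iInter fun i =>
      (by fun_prop : Measurable fun x : E => x i) measurableSet_Ioc
  obtain ⟨C, hC⟩ := (isCompact_closedBall (0 : E) (2 * Real.pi)).exists_bound_of_continuousOn
    hf.continuousOn
  refine MemLp.of_bound hf.aestronglyMeasurable C ?_
  rw [torusMeasure]
  exact (ae_restrict_mem hmeas).mono fun x hx => hC x (cell_subset hx)

/-- The `L²` class on the torus of a continuous function. -/
def toL2 {F : Type*} [NormedAddCommGroup F] (f : E → F) (hf : Continuous f) :
    Lp F 2 torusMeasure :=
  (memLp_of_continuous hf).toLp f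

/-- The classical gradient of a vector field: the entry with index `(i, j)` is `∂ᵢ fⱼ`. -/
def gradField (f : E → E) (x : E) : Mat :=
  WithLp.toLp 2 fun p : Fin 3 × Fin 3 => (fderiv ℝ f x (e p.1)) p.2

/-- The classical divergence of a vector field. -/
def divergence (f : E → E) (x : E) : ℝ := ∑ i, (fderiv ℝ f x (e i)) i

/-- The transport term `((v, ∇) f)(x) = ∑ᵢ vᵢ(x) ∂ᵢ f(x)`. -/
def transport (v f : E → E) (x : E) : E := fderiv ℝ f x (v x)

theorem continuous_gradient {ψ : E → ℝ} (hψ : ContDiff ℝ ∞ ψ) : Continuous (gradient ψ) := by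
  unfold gradient
  exact (InnerProductSpace.toDual ℝ E).symm.continuous.comp
    (hψ.continuous_fderiv (by simp))

theorem continuous_gradField {f : E → E} (hf : ContDiff ℝ ∞ f) : Continuous (gradField f) := by
  have h := hf.continuous_fderiv (by simp)
  unfold gradField
  fun_prop

theorem continuous_transport {f : E → E} (hf : ContDiff ℝ ∞ f) :
    Continuous (transport f f) := by
  have h := hf.continuous_fderiv (by simp)
  have h' := hf.continuous
  unfold transport
  fun_prop

theorem continuous_laplacian {f : E → E} (hf : ContDiff ℝ ∞ f) : Continuous (Δ f) := by
  rw [InnerProductSpace.laplacian_eq_iteratedFDeriv_stdOrthonormalBasis]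
  have h := hf.continuous_iteratedFDeriv (m := 2) (WithTop.coe_le_coe.2 (le_top : (2 : ℕ∞) ≤ ⊤))
  fun_prop

/-- The divergence-free fields in `L²`: the orthogonal complement of the gradients of smooth
periodic functions. -/
def L2sigma : Submodule ℝ L2 :=
  (Submodule.span ℝ {w : L2 | ∃ (ψ : E → ℝ) (hψ : ContDiff ℝ ∞ ψ), IsPeriodic ψ ∧
    w = toL2 (gradient ψ) (continuous_gradient hψ)})ᗮ

instance : L2sigma.HasOrthogonalProjection := by
  have : CompleteSpace L2sigma :=
    (Submodule.isClosed_orthogonal _).completeSpace_coe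
  exact Submodule.HasOrthogonalProjection.ofCompleteSpace L2sigma

/-- The Leray projector `Π`, the orthogonal projection of `L²` onto the divergence-free fields. -/
def leray : L2 →L[ℝ] L2 := L2sigma.starProjection

/-- `G` is the weak gradient on the torus of the vector field `v`, `Gᵢⱼ = ∂ᵢ vⱼ`. -/
def IsWeakGradient (v : L2) (G : L2Mat) : Prop :=
  ∀ ψ : E → ℝ, ContDiff ℝ ∞ ψ → IsPeriodic ψ → ∀ i j : Fin 3,
    ∫ x, v x j * fderiv ℝ ψ x (e i) ∂torusMeasure = -∫ x, G x (i, j) * ψ x ∂torusMeasure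

theorem integrable_coord_mul {ι : Type*} [Fintype ι] (v : Lp (EuclideanSpace ℝ ι) 2 torusMeasure)
    (j : ι) {f : E → ℝ} (hf : Continuous f) :
    Integrable (fun x => v x j * f x) torusMeasure := by
  have h1 : MemLp (fun x => v x j) 2 torusMeasure :=
    (Lp.memLp v).continuousLinearMap_comp (EuclideanSpace.proj (𝕜 := ℝ) j)
  exact h1.integrable_mul (memLp_of_continuous hf)

theorem continuous_partial {ψ : E → ℝ} (hψ : ContDiff ℝ ∞ ψ) (i : Fin 3) :
    Continuous fun x => fderiv ℝ ψ x (e i) := by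
  have h := hψ.continuous_fderiv (by simp)
  fun_prop

theorem integral_coord_add {ι : Type*} [Fintype ι]
    (v w : Lp (EuclideanSpace ℝ ι) 2 torusMeasure) (j : ι) {f : E → ℝ} (hf : Continuous f) :
    ∫ x, (v + w) x j * f x ∂torusMeasure
      = ∫ x, v x j * f x ∂torusMeasure + ∫ x, w x j * f x ∂torusMeasure := by
  rw [← integral_add (integrable_coord_mul v j hf) (integrable_coord_mul w j hf)]
  refine integral_congr_ae ?_
  filter_upwards [Lp.coeFn_add v w] with x hx
  rw [hx]; simp [add_mul]

theorem integral_coord_smul {ι : Type*} [Fintype ι] (c : ℝ)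
    (v : Lp (EuclideanSpace ℝ ι) 2 torusMeasure) (j : ι) (f : E → ℝ) :
    ∫ x, (c • v) x j * f x ∂torusMeasure = c * ∫ x, v x j * f x ∂torusMeasure := by
  rw [← integral_const_mul]
  refine integral_congr_ae ?_
  filter_upwards [Lp.coeFn_smul c v] with x hx
  rw [hx]; simp [mul_assoc]

theorem IsWeakGradient.add {v w : L2} {G K : L2Mat} (h : IsWeakGradient v G)
    (h' : IsWeakGradient w K) : IsWeakGradient (v + w) (G + K) := by
  intro ψ hψ hp i j
  rw [integral_coord_add v w j (continuous_partial hψ i),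
    integral_coord_add G K (i, j) hψ.continuous, h ψ hψ hp, h' ψ hψ hp]
  ring

theorem IsWeakGradient.smul (c : ℝ) {v : L2} {G : L2Mat} (h : IsWeakGradient v G) :
    IsWeakGradient (c • v) (c • G) := by
  intro ψ hψ hp i j
  rw [integral_coord_smul, integral_coord_smul c G (i, j), h ψ hψ hp]
  ring

theorem isWeakGradient_zero : IsWeakGradient 0 0 := by
  have h0 : ∀ {ι : Type} [Fintype ι] (j : ι) (f : E → ℝ),
      ∫ x, (0 : Lp (EuclideanSpace ℝ ι) 2 torusMeasure) x j * f x ∂torusMeasure = 0 := by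
    intro ι _ j f
    have := integral_coord_smul 0 (0 : Lp (EuclideanSpace ℝ ι) 2 torusMeasure) j f
    simpa using this
  intro ψ _ _ i j
  rw [h0 j, h0 (i, j), neg_zero]

/-- The space of divergence-free `H¹` vector fields on the torus.  A field is stored together with
its (uniquely determined) weak gradient, as a pair `(v, ∇v)`; the topology is that of `H¹`, which
is also the topology of each norm `‖v‖² + α ‖∇v‖²` with `α > 0`. -/
def H : Submodule ℝ (WithLp 2 (L2 × L2Mat)) where
  carrier := {u | u.fst ∈ L2sigma ∧ IsWeakGradient u.fst u.snd}
  add_mem' ha hb := ⟨L2sigma.add_mem ha.1 hb.1, ha.2.add hb.2⟩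
  zero_mem' := ⟨L2sigma.zero_mem, isWeakGradient_zero⟩
  smul_mem' c _ ha := ⟨L2sigma.smul_mem c ha.1, ha.2.smul c⟩

/-- The underlying `L²` vector field of an element of `H`. -/
def vel (u : H) : L2 := u.1.fst

/-- The weak gradient of an element of `H`. -/
def grad (u : H) : L2Mat := u.1.snd

/-- The square of the norm `‖z‖²_{𝓗_α} = ‖z‖²_{L²} + α ‖∇z‖²_{L²}` of a field `z` with gradient
`Z`. -/
def normSq (α : ℝ) (z : L2) (Z : L2Mat) : ℝ := ‖z‖ ^ 2 + α * ‖Z‖ ^ 2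

/-- The scalar product of `𝓗_α`. -/
def innerH (α : ℝ) (z : L2) (Z : L2Mat) (w : L2) (W : L2Mat) : ℝ :=
  ⟪z, w⟫_ℝ + α * ⟪Z, W⟫_ℝ

/-- The trilinear term `((u, ∇) u, ψ) = ∫ ∑ᵢⱼ uᵢ (∂ᵢ uⱼ) ψⱼ dx`. -/
def convection (u : H) (ψ : E → E) : ℝ :=
  ∫ x, ∑ i, ∑ j, vel u x i * grad u x (i, j) * ψ x j ∂torusMeasure

/-- `u` is a solution, of class `C¹([0, ∞); 𝓗_α)`, of
`∂ₜu - α ∂ₜΔu + (u, ∇)u + ∇p + γ (u - α Δu) = g`, `div u = 0`, `u(0) = u₀`.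
The equation holds for every `t ≥ 0` in the weak sense: it is tested with all smooth
divergence-free periodic fields `ψ`, which eliminates the pressure `p`. -/
structure IsStrongSolution (α γ : ℝ) (g : L2) (u₀ : H) (u : ℝ → H) : Prop where
  contDiffOn : ContDiffOn ℝ 1 u (Ici 0)
  initial : u 0 = u₀
  equation : ∀ t, 0 ≤ t → ∀ (ψ : E → E) (hψ : ContDiff ℝ ∞ ψ), IsPeriodic ψ →
    (∀ x, divergence ψ x = 0) →
      innerH α (vel (derivWithin u (Ici 0) t)) (grad (derivWithin u (Ici 0) t))
          (toL2 ψ hψ.continuous) (toL2 (gradField ψ) (continuous_gradField hψ))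
        + convection (u t) ψ
        + γ * innerH α (vel (u t)) (grad (u t))
          (toL2 ψ hψ.continuous) (toL2 (gradField ψ) (continuous_gradField hψ))
      = ⟪g, toL2 ψ hψ.continuous⟫_ℝ

/-- A test field: smooth in time and space, periodic and divergence free in space. -/
structure IsTestField (φ : ℝ → E → E) : Prop where
  smooth : ContDiff ℝ ∞ (Function.uncurry φ)
  periodic : ∀ t, IsPeriodic (φ t)
  div_free : ∀ t x, divergence (φ t) x = 0

/-- The time derivative of a test field, at time `t`. -/
def timeDeriv (φ : ℝ → E → E) (t : ℝ) (x : E) : E := deriv (fun s => φ s x) t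

theorem IsTestField.contDiff {φ : ℝ → E → E} (hφ : IsTestField φ) (t : ℝ) :
    ContDiff ℝ ∞ (φ t) :=
  hφ.smooth.comp (contDiff_const.prodMk contDiff_id)

theorem IsTestField.contDiff_timeDeriv {φ : ℝ → E → E} (hφ : IsTestField φ) (t : ℝ) :
    ContDiff ℝ ∞ (timeDeriv φ t) := by
  have h : ContDiff ℝ ∞ (Function.uncurry fun (x : E) (s : ℝ) => φ s x) :=
    hφ.smooth.comp (contDiff_snd.prodMk contDiff_fst)
  exact h.fderiv_apply (g := fun _ => t) (k := fun _ => (1 : ℝ)) contDiff_const contDiff_const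
    (by simp)

/-- `D_α(φ)(t) = ∂ₜφ - α ∂ₜΔφ + Π (φ, ∇)φ + γ (φ - α Δφ) - Π g`. -/
def residual (α γ : ℝ) (g : L2) {φ : ℝ → E → E} (hφ : IsTestField φ) (t : ℝ) : L2 :=
  toL2 (timeDeriv φ t) (hφ.contDiff_timeDeriv t).continuous
    - α • toL2 (Δ (timeDeriv φ t)) (continuous_laplacian (hφ.contDiff_timeDeriv t))
    + leray (toL2 (transport (φ t) (φ t)) (continuous_transport (hφ.contDiff t)))
    + γ • (toL2 (φ t) (hφ.contDiff t).continuous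
        - α • toL2 (Δ (φ t)) (continuous_laplacian (hφ.contDiff t)))
    - leray g

/-- `e_α(φ)(t) = sup_z (-((z, ∇)φ(t), z)) / ‖z‖²_{𝓗_α}`, the supremum being over the nonzero
`z ∈ 𝓗_α`. -/
def growthRate (α : ℝ) (φ : ℝ → E → E) (t : ℝ) : ℝ :=
  ⨆ z : {z : H // z ≠ 0},
    (-∫ x, ⟪transport (vel z.1) (φ t) x, vel z.1 x⟫_ℝ ∂torusMeasure)
      / normSq α (vel z.1) (grad z.1)

/-- `‖v - φ(t)‖²_{𝓗_α}`. -/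
def distSq (α : ℝ) (v : H) {φ : ℝ → E → E} (hφ : IsTestField φ) (t : ℝ) : ℝ :=
  normSq α (vel v - toL2 (φ t) (hφ.contDiff t).continuous)
    (grad v - toL2 (gradField (φ t)) (continuous_gradField (hφ.contDiff t)))

/-- `v` is a dissipative solution with initial data `v₀`: it is locally bounded and weakly
continuous on `[0, ∞)` with values in `𝓗_α`, and satisfies the variational inequality for all
test fields and all times. -/
structure IsDissipativeSolution (α γ : ℝ) (g : L2) (v₀ : H) (v : ℝ → H) : Prop where
  locallyBounded : ∀ T : ℝ, ∃ C : ℝ, ∀ t ∈ Icc 0 T, normSq α (vel (v t)) (grad (v t)) ≤ C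
  weaklyContinuous : ∀ l : H →L[ℝ] ℝ, ContinuousOn (fun t => l (v t)) (Ici 0)
  initial : v 0 = v₀
  inequality : ∀ (φ : ℝ → E → E) (hφ : IsTestField φ) (t : ℝ), 0 ≤ t →
    distSq α (v t) hφ t ≤
      distSq α (v 0) hφ 0 * Real.exp (-2 * ∫ s in (0 : ℝ)..t, (γ - growthRate α φ s))
      - 2 * ∫ τ in (0 : ℝ)..t,
          Real.exp (-2 * ∫ s in τ..t, (γ - growthRate α φ s))
            * ⟪residual α γ g hφ τ, vel (v τ) - toL2 (φ τ) (hφ.contDiff τ).continuous⟫_ℝ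

end BardinaEuler

end

/-! The term `-α ∂ₜΔu` turns the equation into an ordinary differential equation in the Hilbert
space `H`. Let `a` be the scalar product of `𝓗_α` and `B(u, w, z) = ((u, ∇)w, z)`. By Hölder and the
embedding of `H¹` into `L⁴` in dimension three, `B` is a bounded trilinear form on `H`. Hence
Lax–Milgram defines a field `F` on `H` by `a(F(u), z) = (g, z) - B(u, u, z) - γ a(u, z)`. It is
quadratic, so Lipschitz on balls. Smooth solenoidal fields are dense in `H`
(`smoothH_topologicalClosure`), so a strong solution is exactly a solution of `u' = F(u)`
(`eq_bardinaField_iff`). Skew-symmetry `B(u, w, w) = 0` (`triL_self_right`) and damping bound the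
energy, and Picard–Lindelöf gives a unique global solution (`exists_solution`, `solution_unique`).

For a test field `φ` with curve `Φ` in `H`, the pairing `(D_α(φ), z)` equals `a(Φ' - F(Φ), z)`
(`inner_residual`). With `w = u - Φ`, skew-symmetry reduces `B(u, u, w) - B(Φ, Φ, w)` to `B(w, Φ,
w)`, which `e_α` controls. Grönwall then gives the dissipative inequality for the strong solution
(`relative_energy_le`).

For uniqueness, the strong solution `u` is approximated by test fields in `C¹([0, T]; H)`
(`IsTestClass.exists_near`). When such approximations are inserted in the inequality for a
dissipative solution `v`, the initial term and the defect `Φ' - F(Φ)` tend to zero while the rates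
`e_α` stay bounded. This forces `v(T) = u(T)` (`eq_of_energy_inequality`). -/

noncomputable section

set_option maxSynthPendingDepth 3

namespace BardinaEuler

/-! ### `L²` classes of continuous functions on the cell. -/

section Basics

variable {F : Type*} [NormedAddCommGroup F]

theorem measurableSet_cell : MeasurableSet cell := by
  have : cell = ⋂ i, (fun x : E => x i) ⁻¹' Ioc (-Real.pi) Real.pi := by
    ext x; simp [cell]
  rw [this]
  exact MeasurableSet.iInter fun i =>
    (by fun_prop : Measurable fun x : E => x i) measurableSet_Ioc

instance : IsFiniteMeasure torusMeasure := by
  refine ⟨?_⟩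
  rw [torusMeasure, Measure.restrict_apply_univ]
  exact (measure_mono cell_subset).trans_lt
    (isCompact_closedBall (0 : E) (2 * Real.pi)).measure_lt_top

theorem coeFn_toL2 {f : E → F} (hf : Continuous f) : toL2 f hf =ᵐ[torusMeasure] f :=
  MemLp.coeFn_toLp _

theorem toL2_congr {f g : E → F} (h : f = g) (hf : Continuous f) (hg : Continuous g) :
    toL2 f hf = toL2 g hg := by
  subst h; rfl

theorem toL2_add {f g : E → F} (hf : Continuous f) (hg : Continuous g) :
    toL2 (fun x => f x + g x) (hf.add hg) = toL2 f hf + toL2 g hg := rfl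

theorem integrable_of_continuous {f : E → F} (hf : Continuous f) :
    Integrable f torusMeasure :=
  (memLp_of_continuous hf).integrable (by norm_num)

/-- A constant comparing the `L²` norm with the supremum norm. -/
def volConst : ℝ := (measureUnivNNReal torusMeasure : ℝ) ^ (2 : ENNReal).toReal⁻¹

theorem volConst_nonneg : 0 ≤ volConst := by unfold volConst; positivity

theorem norm_toL2_le {f : E → F} (hf : Continuous f) {C : ℝ} (hC : 0 ≤ C)
    (h : ∀ x ∈ cell, ‖f x‖ ≤ C) : ‖toL2 f hf‖ ≤ volConst * C := by
  have := Lp.norm_le_of_ae_bound (f := toL2 f hf) hC (by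
    filter_upwards [coeFn_toL2 hf, ae_restrict_mem measurableSet_cell] with x hx hx'
    rw [hx]; exact h x hx')
  simpa [volConst] using this

theorem inner_toL2 [InnerProductSpace ℝ F] (v : Lp F 2 torusMeasure) {f : E → F}
    (hf : Continuous f) : ⟪v, toL2 f hf⟫_ℝ = ∫ x, ⟪v x, f x⟫_ℝ ∂torusMeasure := by
  rw [L2.inner_def]
  refine integral_congr_ae ?_
  filter_upwards [coeFn_toL2 hf] with x hx
  rw [hx]

theorem inner_toL2_toL2 [InnerProductSpace ℝ F] {f g : E → F} (hf : Continuous f)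
    (hg : Continuous g) : ⟪toL2 f hf, toL2 g hg⟫_ℝ = ∫ x, ⟪f x, g x⟫_ℝ ∂torusMeasure := by
  rw [inner_toL2]
  refine integral_congr_ae ?_
  filter_upwards [coeFn_toL2 hf] with x hx
  rw [hx]

theorem continuous_single {ι : Type*} [Fintype ι] [DecidableEq ι] (j : ι) {f : E → ℝ}
    (hf : Continuous f) : Continuous fun x => EuclideanSpace.single j (f x) := by
  have : (fun x => EuclideanSpace.single j (f x))
      = fun x => f x • EuclideanSpace.single j (1 : ℝ) := by
    ext x i
    by_cases h : i = j <;> simp [h]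
  rw [this]
  fun_prop

theorem integral_coord_mul_eq_inner {ι : Type*} [Fintype ι] [DecidableEq ι]
    (v : Lp (EuclideanSpace ℝ ι) 2 torusMeasure) (j : ι) {f : E → ℝ} (hf : Continuous f) :
    ∫ x, v x j * f x ∂torusMeasure
      = ⟪v, toL2 (fun x => EuclideanSpace.single j (f x)) (continuous_single j hf)⟫_ℝ := by
  rw [inner_toL2]
  refine integral_congr_ae (Filter.Eventually.of_forall fun x => ?_)
  simp [EuclideanSpace.inner_single_right, mul_comm]

theorem inner_toL2_eq_sum {ι : Type*} [Fintype ι]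
    (v : Lp (EuclideanSpace ℝ ι) 2 torusMeasure) {f : E → EuclideanSpace ℝ ι}
    (hf : Continuous f) :
    ⟪v, toL2 f hf⟫_ℝ = ∑ j, ∫ x, v x j * f x j ∂torusMeasure := by
  rw [inner_toL2, ← integral_finsetSum _ fun j _ => integrable_coord_mul v j (by fun_prop)]
  refine integral_congr_ae (Filter.Eventually.of_forall fun x => ?_)
  simp [PiLp.inner_apply, mul_comm]

end Basics

/-! ### Integration by parts for periodic functions. -/

section Periodic

variable {F : Type*} [NormedAddCommGroup F] [NormedSpace ℝ F]

theorem IsPeriodic.fderiv {f : E → F} (hf : IsPeriodic f) : IsPeriodic (fderiv ℝ f) := by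
  intro i x
  have : (fun y => f (y + (2 * Real.pi) • e i)) = f := funext (hf i)
  rw [← fderiv_comp_add_right, this]

theorem IsPeriodic.comp {G K : Type*} {f : E → G} (hf : IsPeriodic f) (g : G → K) :
    IsPeriodic (fun x => g (f x)) := fun i x => congrArg g (hf i x)

theorem IsPeriodic.comp₂ {G G' K : Type*} {f : E → G} {f' : E → G'} (hf : IsPeriodic f)
    (hf' : IsPeriodic f') (g : G → G' → K) : IsPeriodic (fun x => g (f x) (f' x)) :=
  fun i x => by simp only [hf i x, hf' i x]

theorem integral_cell_eq (f : E → ℝ) :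
    ∫ x, f x ∂torusMeasure
      = ∫ y in Icc (fun _ : Fin 3 => -Real.pi) (fun _ => Real.pi), f (WithLp.toLp 2 y) := by
  have h := (PiLp.volume_preserving_toLp (Fin 3)).setIntegral_preimage_emb
    (MeasurableEquiv.toLp 2 (Fin 3 → ℝ)).measurableEmbedding f cell
  rw [torusMeasure, ← h]
  refine setIntegral_congr_set ?_
  have h2 : (WithLp.toLp 2 ⁻¹' cell : Set (Fin 3 → ℝ))
      = univ.pi fun _ => Ioc (-Real.pi) Real.pi := by
    ext y; simp [cell]
  rw [h2]
  exact Measure.univ_pi_Ioc_ae_eq_Icc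

/-- Divergence theorem on the box for the field whose only nonzero component is `h` in direction
`i`: the two remaining faces carry opposite fluxes by periodicity. -/
theorem integral_partial_eq_zero {h : E → ℝ} (hh : ContDiff ℝ 1 h) (hp : IsPeriodic h)
    (i : Fin 3) : ∫ x, fderiv ℝ h x (e i) ∂torusMeasure = 0 := by
  rw [integral_cell_eq]
  set L : (Fin 3 → ℝ) ≃L[ℝ] E := (PiLp.continuousLinearEquiv 2 ℝ (fun _ : Fin 3 => ℝ)).symm
  have hL : ∀ y, L y = WithLp.toLp 2 y := fun _ => rfl
  have hd : Differentiable ℝ h := hh.differentiable (by simp)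
  have hcd : Continuous (fderiv ℝ h) := hh.continuous_fderiv (by simp)
  have key := integral_divergence_of_hasFDerivAt_off_countable'
    (fun _ : Fin 3 => -Real.pi) (fun _ => Real.pi)
    (fun _ => by simp only; linarith [Real.pi_pos])
    (fun j y => if j = i then h (L y) else 0)
    (fun j y => if j = i then (fderiv ℝ h (L y)).comp (L : (Fin 3 → ℝ) →L[ℝ] E) else 0)
    ∅ countable_empty
    (fun j => by
      by_cases hj : j = i <;> simp only [hj, if_true, if_false]
      · exact (hh.continuous.comp L.continuous).continuousOn
      · exact continuousOn_const)
    (fun x _ j => by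
      by_cases hj : j = i <;> simp only [hj, if_true, if_false]
      · exact (hd (L x)).hasFDerivAt.comp x L.hasFDerivAt
      · exact hasFDerivAt_const _ _)
    (by
      refine Continuous.integrableOn_Icc ?_
      refine continuous_finsetSum _ fun j _ => ?_
      by_cases hj : j = i <;> simp only [hj, if_true, if_false]
      · have := L.continuous
        simp only [ContinuousLinearMap.comp_apply]
        fun_prop
      · exact continuous_const)
  have hlhs : ∀ y : Fin 3 → ℝ, (∑ j, (if j = i then (fderiv ℝ h (L y)).comp
      (L : (Fin 3 → ℝ) →L[ℝ] E) else 0) (Pi.single j 1)) = fderiv ℝ h (WithLp.toLp 2 y) (e i) := by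
    intro y
    rw [Finset.sum_eq_single i]
    · simp [hL, e]
    · intro j _ hj; simp [hj]
    · simp
  simp only [hlhs] at key
  rw [key]
  refine Finset.sum_eq_zero fun j _ => ?_
  by_cases hj : j = i
  · simp only [hj, if_true]
    rw [sub_eq_zero]
    refine integral_congr_ae (Filter.Eventually.of_forall fun x => ?_)
    have := hp i (L (i.insertNth (-Real.pi) x))
    simp only
    rw [← this]
    congr 1
    ext k
    refine Fin.succAboveCases i ?_ (fun k => ?_) k
    · simp [hL]; ring
    · simp [hL]
  · simp [hj]

theorem integral_mul_partial {h k : E → ℝ} (hh : ContDiff ℝ 1 h) (hp : IsPeriodic h)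
    (hk : ContDiff ℝ 1 k) (kp : IsPeriodic k) (i : Fin 3) :
    ∫ x, h x * fderiv ℝ k x (e i) ∂torusMeasure
      = -∫ x, fderiv ℝ h x (e i) * k x ∂torusMeasure := by
  have h0 := integral_partial_eq_zero (hh.mul hk) (hp.comp₂ kp (· * ·)) i
  have hch := hh.continuous_fderiv (by simp)
  have hck := hk.continuous_fderiv (by simp)
  have hch' := hh.continuous
  have hck' := hk.continuous
  have he : ∀ x, fderiv ℝ (fun x => h x * k x) x (e i)
      = h x * fderiv ℝ k x (e i) + fderiv ℝ h x (e i) * k x := fun x => by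
    rw [fderiv_fun_mul (hh.differentiable (by simp) x) (hk.differentiable (by simp) x)]
    simp [mul_comm]
  have h0' : ∫ x, (h x * fderiv ℝ k x (e i) + fderiv ℝ h x (e i) * k x) ∂torusMeasure = 0 := by
    rw [← h0]; exact integral_congr_ae (Filter.Eventually.of_forall fun x => (he x).symm)
  rw [integral_add (integrable_of_continuous (by fun_prop))
    (integrable_of_continuous (by fun_prop))] at h0'
  linarith

end Periodic

/-! ### Smooth solenoidal fields as elements of `H`. -/

section SmoothFields

/-- A smooth, periodic, divergence-free vector field. -/
structure IsSmoothSolenoidal (ψ : E → E) : Prop where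
  smooth : ContDiff ℝ ∞ ψ
  periodic : IsPeriodic ψ
  div_free : ∀ x, divergence ψ x = 0

theorem fderiv_coord {ψ : E → E} (hψ : ContDiff ℝ ∞ ψ) (j : Fin 3) (x v : E) :
    fderiv ℝ (fun y => ψ y j) x v = fderiv ℝ ψ x v j := by
  have h := (hψ.differentiable (by simp) x).hasFDerivAt
  have := (EuclideanSpace.proj (𝕜 := ℝ) j : E →L[ℝ] ℝ).hasFDerivAt.comp x h
  rw [HasFDerivAt.fderiv (f := fun y => ψ y j) this]
  rfl

theorem contDiff_coord {ψ : E → E} (hψ : ContDiff ℝ ∞ ψ) (j : Fin 3) :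
    ContDiff ℝ ∞ fun y => ψ y j := by
  fun_prop

theorem sum_smul_e (v : E) : ∑ i, v i • e i = v := by
  ext k
  fin_cases k <;> simp [Fin.sum_univ_three]

theorem clm_apply_eq_sum {F : Type*} [NormedAddCommGroup F] [NormedSpace ℝ F] (A : E →L[ℝ] F)
    (v : E) : A v = ∑ i, v i • A (e i) := by
  conv_lhs => rw [← sum_smul_e v]
  simp

theorem isWeakGradient_smooth {ψ : E → E} (hψ : ContDiff ℝ ∞ ψ) (hp : IsPeriodic ψ) :
    IsWeakGradient (toL2 ψ hψ.continuous) (toL2 (gradField ψ) (continuous_gradField hψ)) := by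
  intro χ hχ hχp i j
  have h1 : ∫ x, toL2 ψ hψ.continuous x j * fderiv ℝ χ x (e i) ∂torusMeasure
      = ∫ x, ψ x j * fderiv ℝ χ x (e i) ∂torusMeasure := by
    refine integral_congr_ae ?_
    filter_upwards [coeFn_toL2 hψ.continuous] with x hx
    rw [hx]
  have h2 : ∫ x, toL2 (gradField ψ) (continuous_gradField hψ) x (i, j) * χ x ∂torusMeasure
      = ∫ x, fderiv ℝ (fun y => ψ y j) x (e i) * χ x ∂torusMeasure := by
    refine integral_congr_ae ?_
    filter_upwards [coeFn_toL2 (continuous_gradField hψ)] with x hx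
    rw [hx, fderiv_coord hψ]
    rfl
  rw [h1, h2]
  exact integral_mul_partial ((contDiff_coord hψ j).of_le (by simp)) (hp.comp (· j))
    (hχ.of_le (by simp)) hχp i

/-- Pairing with a gradient and integrating by parts leaves the classical divergence, which
vanishes. -/
theorem toL2_mem_L2sigma {ψ : E → E} (hψ : IsSmoothSolenoidal ψ) :
    toL2 ψ hψ.smooth.continuous ∈ L2sigma := by
  rw [L2sigma, Submodule.mem_orthogonal']
  intro w hw
  induction hw using Submodule.span_induction with
  | zero => simp
  | add x y _ _ hx hy => rw [inner_add_right, hx, hy, add_zero]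
  | smul c x _ hx => rw [inner_smul_right, hx, mul_zero]
  | mem w hw =>
    obtain ⟨χ, hχ, hχp, rfl⟩ := hw
    have hs := hψ.smooth
    have hc := hs.continuous
    have hcd := hs.continuous_fderiv (by simp)
    have hχc := hχ.continuous
    have hg := continuous_gradient hχ
    rw [inner_toL2_toL2]
    have h1 : ∀ x, ⟪ψ x, gradient χ x⟫_ℝ = ∑ i, ψ x i * fderiv ℝ χ x (e i) := fun x => by
      rw [real_inner_comm, gradient, InnerProductSpace.toDual_symm_apply, clm_apply_eq_sum]
      rfl
    simp_rw [h1]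
    have hcχ := continuous_partial hχ
    rw [integral_finsetSum _ fun i _ => integrable_of_continuous (by fun_prop)]
    have h2 : ∀ i, ∫ x, ψ x i * fderiv ℝ χ x (e i) ∂torusMeasure
        = -∫ x, fderiv ℝ ψ x (e i) i * χ x ∂torusMeasure := fun i => by
      rw [integral_mul_partial ((contDiff_coord hs i).of_le (by simp)) (hψ.periodic.comp (· i))
        (hχ.of_le (by simp)) hχp i]
      simp_rw [fderiv_coord hs]
    simp_rw [h2]
    rw [Finset.sum_neg_distrib, ← integral_finsetSum _ fun i _ => integrable_of_continuous
      (by fun_prop)]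
    have h3 : ∀ x, ∑ i, fderiv ℝ ψ x (e i) i * χ x = 0 := fun x => by
      rw [← Finset.sum_mul]
      have := hψ.div_free x
      rw [divergence] at this
      rw [this, zero_mul]
    simp_rw [h3]
    simp

/-- The element of `H` given by a smooth periodic divergence-free field. -/
def ofSmooth (ψ : E → E) (hψ : IsSmoothSolenoidal ψ) : H :=
  ⟨WithLp.toLp 2 (toL2 ψ hψ.smooth.continuous,
    toL2 (gradField ψ) (continuous_gradField hψ.smooth)),
    toL2_mem_L2sigma hψ, isWeakGradient_smooth hψ.smooth hψ.periodic⟩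

@[simp] theorem vel_ofSmooth {ψ : E → E} (hψ : IsSmoothSolenoidal ψ) :
    vel (ofSmooth ψ hψ) = toL2 ψ hψ.smooth.continuous := rfl

@[simp] theorem grad_ofSmooth {ψ : E → E} (hψ : IsSmoothSolenoidal ψ) :
    grad (ofSmooth ψ hψ) = toL2 (gradField ψ) (continuous_gradField hψ.smooth) := rfl

theorem vel_mem (u : H) : vel u ∈ L2sigma := u.2.1

theorem isWeakGradient_grad (u : H) : IsWeakGradient (vel u) (grad u) := u.2.2

/-- The velocity as a continuous linear map. -/
def velL : H →L[ℝ] L2 := (WithLp.fstL 2 ℝ L2 L2Mat).comp H.subtypeL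

/-- The gradient as a continuous linear map. -/
def gradL : H →L[ℝ] L2Mat := (WithLp.sndL 2 ℝ L2 L2Mat).comp H.subtypeL

theorem inner_H (u v : H) : ⟪u, v⟫_ℝ = ⟪vel u, vel v⟫_ℝ + ⟪grad u, grad v⟫_ℝ := rfl

theorem norm_sq_H (u : H) : ‖u‖ ^ 2 = ‖vel u‖ ^ 2 + ‖grad u‖ ^ 2 := by
  rw [← real_inner_self_eq_norm_sq, inner_H, real_inner_self_eq_norm_sq,
    real_inner_self_eq_norm_sq]

theorem norm_vel_le (u : H) : ‖vel u‖ ≤ ‖u‖ := by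
  have := norm_sq_H u
  exact le_of_sq_le_sq (by nlinarith [sq_nonneg ‖grad u‖]) (norm_nonneg _)

theorem norm_grad_le (u : H) : ‖grad u‖ ≤ ‖u‖ := by
  have := norm_sq_H u
  exact le_of_sq_le_sq (by nlinarith [sq_nonneg ‖vel u‖]) (norm_nonneg _)

theorem H_ext {u v : H} (h : vel u = vel v) (h' : grad u = grad v) : u = v := by
  apply Subtype.ext
  apply (WithLp.equiv 2 _).injective
  exact Prod.ext h h'

end SmoothFields

/-! ### Completeness of the Fourier system, transported from the unit torus to the cell. -/

section Fourier

local instance : MeasureSpace UnitAddCircle := ⟨AddCircle.haarAddCircle⟩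

local instance : Measure.IsAddHaarMeasure (volume : Measure UnitAddCircle) :=
  inferInstanceAs (Measure.IsAddHaarMeasure AddCircle.haarAddCircle)

local instance : IsProbabilityMeasure (volume : Measure UnitAddCircle) :=
  inferInstanceAs (IsProbabilityMeasure AddCircle.haarAddCircle)

/-- The scalar product of a lattice vector with a point. -/
def latticeDot (k : Fin 3 → ℤ) (x : E) : ℝ := ∑ i, (k i : ℝ) * x i

/-- The identification of the unit torus with the fundamental cell. -/
def torusToCell (y : UnitAddTorus (Fin 3)) : E :=
  WithLp.toLp 2 fun i => 2 * Real.pi * (AddCircle.equivIoc 1 (-1 / 2) (y i)).1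

theorem measurable_torusToCell : Measurable torusToCell := by
  unfold torusToCell
  refine (MeasurableEquiv.toLp 2 (Fin 3 → ℝ)).measurable.comp ?_
  refine measurable_pi_lambda _ fun i => ?_
  refine Measurable.const_mul ?_ _
  exact measurable_subtype_coe.comp
    ((AddCircle.measurableEquivIoc 1 (-1 / 2)).measurable.comp (measurable_pi_apply i))

/-- The density of the image of the Haar measure of the unit torus. -/
def cellDensity : ENNReal := ENNReal.ofReal |((2 * Real.pi) ^ 3)⁻¹|

theorem cellDensity_ne_zero : cellDensity ≠ 0 := by
  have := Real.pi_pos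
  simp [cellDensity, this.ne']

/-- The map is the chart onto `(-1/2, 1/2]³` followed by dilation by `2π`; the dilation accounts for
the density `(2π)⁻³`. -/
theorem measurePreserving_torusToCell :
    MeasurePreserving torusToCell volume (cellDensity • torusMeasure) := by
  refine ⟨measurable_torusToCell, ?_⟩
  set S : (Fin 3 → ℝ) → E := fun x => WithLp.toLp 2 ((2 * Real.pi) • x) with hS
  have hpi := Real.pi_pos
  have hSm : Measurable S :=
    (MeasurableEquiv.toLp 2 (Fin 3 → ℝ)).measurable.comp (measurable_const_smul _)
  have hmapS : Measure.map S volume = cellDensity • volume := by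
    have h1 : S = WithLp.toLp 2 ∘ fun x => (2 * Real.pi) • x := rfl
    rw [h1, ← Measure.map_map (PiLp.volume_preserving_toLp (Fin 3)).measurable
      (measurable_const_smul _), Measure.map_addHaar_smul _ (by positivity), Measure.map_smul,
      (PiLp.volume_preserving_toLp (Fin 3)).map_eq]
    simp [cellDensity]
  have hpre : S ⁻¹' cell = {x : Fin 3 → ℝ | ∀ i, x i ∈ Ioc (-1 / 2 : ℝ) (-1 / 2 + 1)} := by
    ext x
    simp only [cell, hS, mem_preimage, mem_ofPred_eq, mem_Ioc, Pi.smul_apply, smul_eq_mul]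
    refine forall_congr' fun i => and_congr ?_ ?_
    · constructor <;> intro h <;> nlinarith
    · constructor <;> intro h <;> nlinarith
  have hrestr : Measure.map S (volume.restrict (S ⁻¹' cell)) = cellDensity • torusMeasure := by
    rw [← Measure.restrict_map hSm measurableSet_cell, hmapS, Measure.restrict_smul, torusMeasure]
  rw [← hrestr]
  ext s hs
  rw [Measure.map_apply measurable_torusToCell hs, Measure.map_apply hSm hs,
    ← lintegral_indicator_one (measurable_torusToCell hs), ← lintegral_indicator_one (hSm hs),
    UnitAddTorus.lintegral_preimage _ (fun _ => -1 / 2), hpre]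
  refine setLIntegral_congr_fun ?_ fun x hx => ?_
  · rw [← hpre]; exact hSm measurableSet_cell
  · have : torusToCell (fun i => (x i : UnitAddCircle)) = S x := by
      ext i
      have h2 : ((AddCircle.equivIoc 1 (-1 / 2 : ℝ) (x i : UnitAddCircle)) : ℝ) = x i := by
        rw [AddCircle.equivIoc_coe_eq (hx i)]
      simp [torusToCell, hS, h2]
    have h3 : (fun i => (x i : UnitAddCircle)) ∈ torusToCell ⁻¹' s ↔ x ∈ S ⁻¹' s := by
      rw [mem_preimage, this, mem_preimage]
    by_cases hx' : x ∈ S ⁻¹' s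
    · rw [indicator_of_mem hx', indicator_of_mem (h3.2 hx')]; rfl
    · rw [indicator_of_notMem hx', indicator_of_notMem (h3.not.2 hx')]

theorem mFourier_neg_eq (k : Fin 3 → ℤ) (y : UnitAddTorus (Fin 3)) :
    UnitAddTorus.mFourier (-k) y
      = (Real.cos (latticeDot k (torusToCell y)) : ℂ)
        - (Real.sin (latticeDot k (torusToCell y)) : ℂ) * Complex.I := by
  have hrep : ∀ i, y i = (((AddCircle.equivIoc 1 (-1 / 2 : ℝ) (y i)).1 : ℝ) : UnitAddCircle) :=
    fun i => AddCircle.coe_equivIoc.symm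
  have h1 : ∀ i, fourier ((-k) i) (y i)
      = Complex.exp (-((k i * (torusToCell y i) : ℝ) : ℂ) * Complex.I) := by
    intro i
    rw [hrep i, fourier_coe_apply]
    congr 1
    simp only [torusToCell, Pi.neg_apply]
    push_cast
    ring
  rw [UnitAddTorus.mFourier, ContinuousMap.coe_mk]
  simp_rw [h1]
  rw [← Complex.exp_sum, ← Finset.sum_mul, Finset.sum_neg_distrib, ← Complex.ofReal_sum]
  change Complex.exp (-((latticeDot k (torusToCell y) : ℝ) : ℂ) * Complex.I) = _
  rw [Complex.exp_mul_I, Complex.cos_neg, Complex.sin_neg, Complex.ofReal_cos, Complex.ofReal_sin]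
  ring

theorem continuous_latticeDot (k : Fin 3 → ℤ) : Continuous (latticeDot k) := by
  unfold latticeDot; fun_prop

/-- A square integrable function all of whose Fourier coefficients vanish is zero. -/
theorem ae_eq_zero_of_fourier {f : E → ℝ} (hm : StronglyMeasurable f)
    (hf : MemLp f 2 torusMeasure)
    (hcos : ∀ k, ∫ x, f x * Real.cos (latticeDot k x) ∂torusMeasure = 0)
    (hsin : ∀ k, ∫ x, f x * Real.sin (latticeDot k x) ∂torusMeasure = 0) :
    f =ᵐ[torusMeasure] 0 := by
  have hT := measurePreserving_torusToCell
  have hF : MemLp (fun y => (f (torusToCell y) : ℂ)) 2 volume := by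
    have h1 : MemLp f 2 (cellDensity • torusMeasure) :=
      hf.smul_measure (by simp [cellDensity])
    exact (h1.comp_measurePreserving hT).ofReal
  have hzero : hF.toLp _ = 0 := by
    -- Coefficients in a Hilbert basis determine the function; each complex coefficient is a
    -- combination of the two vanishing real integrals.
    apply UnitAddTorus.mFourierBasis.repr.injective
    ext k
    rw [UnitAddTorus.mFourierBasis_repr, UnitAddTorus.mFourierCoeff]
    have h1 : ∫ y, UnitAddTorus.mFourier (-k) y • (hF.toLp _ y)
        = ∫ y, (fun x => ((f x * Real.cos (latticeDot k x) : ℝ) : ℂ)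
            - ((f x * Real.sin (latticeDot k x) : ℝ) : ℂ) * Complex.I) (torusToCell y) := by
      refine integral_congr_ae ?_
      filter_upwards [hF.coeFn_toLp] with y hy
      rw [hy, mFourier_neg_eq, smul_eq_mul]
      push_cast
      ring
    have hmeas : AEStronglyMeasurable (fun x => ((f x * Real.cos (latticeDot k x) : ℝ) : ℂ)
            - ((f x * Real.sin (latticeDot k x) : ℝ) : ℂ) * Complex.I)
        (Measure.map torusToCell volume) := by
      have h2 := continuous_latticeDot k
      have h3 := (Real.continuous_cos.comp h2).stronglyMeasurable
      have h4 := (Real.continuous_sin.comp h2).stronglyMeasurable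
      refine StronglyMeasurable.aestronglyMeasurable ?_
      exact (Complex.continuous_ofReal.comp_stronglyMeasurable (hm.mul h3)).sub
        ((Complex.continuous_ofReal.comp_stronglyMeasurable (hm.mul h4)).mul_const _)
    rw [h1, ← integral_map hT.measurable.aemeasurable hmeas, hT.map_eq, integral_smul_measure]
    have hic : Integrable (fun x => f x * Real.cos (latticeDot k x)) torusMeasure :=
      hf.integrable_mul (memLp_of_continuous (Real.continuous_cos.comp (continuous_latticeDot k)))
    have his : Integrable (fun x => f x * Real.sin (latticeDot k x)) torusMeasure :=
      hf.integrable_mul (memLp_of_continuous (Real.continuous_sin.comp (continuous_latticeDot k)))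
    rw [integral_sub hic.ofReal (his.ofReal.mul_const _), integral_mul_const, integral_complex_ofReal,
      integral_complex_ofReal, hcos, hsin]
    simp
  have h0 : ∀ᵐ y, f (torusToCell y) = 0 := by
    have h1 := hF.coeFn_toLp
    rw [hzero] at h1
    filter_upwards [h1, Lp.coeFn_zero ℂ 2 (volume : Measure (UnitAddTorus (Fin 3)))] with y hy hy'
    rw [hy'] at hy
    simpa using hy.symm
  have hset : MeasurableSet {x | f x = 0} := hm.measurable (measurableSet_singleton 0)
  have h2 := (ae_map_iff hT.measurable.aemeasurable hset).2 h0
  rw [hT.map_eq, Measure.ae_ennreal_smul_measure_eq cellDensity_ne_zero] at h2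
  exact h2

end Fourier

/-! ### Completeness of `H`. -/

section Complete

/-- For a fixed test function, the weak gradient identity equates two continuous functionals of the
pair, since both integrals are `L²` scalar products. -/
theorem isClosed_H : IsClosed (H : Set (WithLp 2 (L2 × L2Mat))) := by
  have h1 : Continuous fun u : WithLp 2 (L2 × L2Mat) => u.fst :=
    (WithLp.fstL 2 ℝ L2 L2Mat).continuous
  have h2 : Continuous fun u : WithLp 2 (L2 × L2Mat) => u.snd :=
    (WithLp.sndL 2 ℝ L2 L2Mat).continuous
  have hset : (H : Set (WithLp 2 (L2 × L2Mat)))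
      = {u | u.fst ∈ L2sigma} ∩ {u | IsWeakGradient u.fst u.snd} := rfl
  rw [hset]
  refine IsClosed.inter ?_ ?_
  · exact (Submodule.isClosed_orthogonal _).preimage h1
  · simp only [IsWeakGradient, ofPred_forall]
    refine isClosed_iInter fun ψ => isClosed_iInter fun hψ => isClosed_iInter fun _ =>
      isClosed_iInter fun i => isClosed_iInter fun j => ?_
    simp_rw [integral_coord_mul_eq_inner _ _ (continuous_partial hψ i),
      integral_coord_mul_eq_inner _ _ hψ.continuous]
    exact isClosed_eq (by fun_prop) (by fun_prop)

instance : CompleteSpace H := isClosed_H.completeSpace_coe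

end Complete

/-! ### Plane waves as test functions. -/

section Waves

/-- The plane wave `cos (k · x + s)`. -/
def wave (k : Fin 3 → ℤ) (s : ℝ) (x : E) : ℝ := Real.cos (latticeDot k x + s)

/-- The linear form `x ↦ k · x`. -/
def latticeForm (k : Fin 3 → ℤ) : E →L[ℝ] ℝ :=
  ∑ i, (k i : ℝ) • (EuclideanSpace.proj (𝕜 := ℝ) i : E →L[ℝ] ℝ)

theorem latticeForm_apply (k : Fin 3 → ℤ) (x : E) : latticeForm k x = latticeDot k x := by
  simp [latticeForm, latticeDot]

theorem latticeForm_e (k : Fin 3 → ℤ) (i : Fin 3) : latticeForm k (e i) = k i := by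
  fin_cases i <;> simp [latticeForm, Fin.sum_univ_three]

theorem wave_eq (k : Fin 3 → ℤ) (s : ℝ) :
    wave k s = fun x => Real.cos (latticeForm k x + s) := by
  ext x; rw [latticeForm_apply]; rfl

theorem contDiff_wave (k : Fin 3 → ℤ) (s : ℝ) : ContDiff ℝ ∞ (wave k s) := by
  rw [wave_eq]
  exact Real.contDiff_cos.comp ((latticeForm k).contDiff.add contDiff_const)

/-- Differentiation advances the phase by `π / 2`, so one family with a free phase contains cosines
and sines and is stable under derivatives up to factors. -/
theorem hasFDerivAt_wave (k : Fin 3 → ℤ) (s : ℝ) (x : E) :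
    HasFDerivAt (wave k s) (wave k (s + Real.pi / 2) x • latticeForm k) x := by
  have h := ((latticeForm k).hasFDerivAt (x := x)).add_const s
  have h2 := (Real.hasDerivAt_cos (latticeForm k x + s)).comp_hasFDerivAt x h
  have h3 : Real.cos (latticeForm k x + (s + Real.pi / 2)) = -Real.sin (latticeForm k x + s) := by
    rw [← add_assoc, Real.cos_add_pi_div_two]
  simp only [wave_eq]
  rw [h3]
  exact h2

theorem fderiv_wave (k : Fin 3 → ℤ) (s : ℝ) (x : E) (i : Fin 3) :
    fderiv ℝ (wave k s) x (e i) = wave k (s + Real.pi / 2) x * k i := by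
  rw [(hasFDerivAt_wave k s x).fderiv]
  simp [latticeForm_e]

theorem isPeriodic_wave (k : Fin 3 → ℤ) (s : ℝ) : IsPeriodic (wave k s) := by
  intro i x
  rw [wave_eq]
  simp only [map_add, map_smul, latticeForm_e, smul_eq_mul]
  have : latticeForm k x + 2 * Real.pi * k i + s
      = latticeForm k x + s + (k i : ℤ) * (2 * Real.pi) := by ring
  rw [this, Real.cos_add_int_mul_two_pi]

theorem wave_add_pi (k : Fin 3 → ℤ) (s : ℝ) (x : E) :
    wave k (s + Real.pi / 2 + Real.pi / 2) x = -wave k s x := by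
  rw [wave, wave, ← Real.cos_add_pi]
  congr 1; ring

theorem ae_eq_zero_of_waves {ι : Type*} [Fintype ι] (v : Lp (EuclideanSpace ℝ ι) 2 torusMeasure)
    (j : ι) (h : ∀ k s, ∫ x, v x j * wave k s x ∂torusMeasure = 0) :
    (fun x => v x j) =ᵐ[torusMeasure] 0 := by
  have hc : Continuous fun y : EuclideanSpace ℝ ι => y j := by fun_prop
  refine ae_eq_zero_of_fourier (hc.comp_stronglyMeasurable (Lp.stronglyMeasurable v))
    ((Lp.memLp v).continuousLinearMap_comp (EuclideanSpace.proj (𝕜 := ℝ) j)) (fun k => ?_)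
    (fun k => ?_)
  · simpa [wave] using h k 0
  -- The phase `-π / 2` turns the cosine into the sine.
  · have := h k (-(Real.pi / 2))
    simpa [wave, ← sub_eq_add_neg, Real.cos_sub_pi_div_two] using this

theorem eq_zero_of_waves {ι : Type*} [Fintype ι] (v : Lp (EuclideanSpace ℝ ι) 2 torusMeasure)
    (h : ∀ j k s, ∫ x, v x j * wave k s x ∂torusMeasure = 0) : v = 0 := by
  rw [Lp.eq_zero_iff_ae_eq_zero]
  have h1 : ∀ᵐ x ∂torusMeasure, ∀ j, v x j = 0 :=
    ae_all_iff.2 fun j => ae_eq_zero_of_waves v j (h j)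
  filter_upwards [h1] with x hx
  ext j
  exact hx j

/-- The vector-valued plane wave `cos (k · x + s) a`. -/
def vectorWave (k : Fin 3 → ℤ) (s : ℝ) (a : E) (x : E) : E := wave k s x • a

theorem contDiff_vectorWave (k : Fin 3 → ℤ) (s : ℝ) (a : E) : ContDiff ℝ ∞ (vectorWave k s a) :=
  (contDiff_wave k s).smul contDiff_const

theorem fderiv_vectorWave (k : Fin 3 → ℤ) (s : ℝ) (a : E) (x : E) (i : Fin 3) :
    fderiv ℝ (vectorWave k s a) x (e i) = (wave k (s + Real.pi / 2) x * k i) • a := by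
  have := (hasFDerivAt_wave k s x).smul_const a
  rw [HasFDerivAt.fderiv (f := vectorWave k s a) this]
  simp [latticeForm_e]

theorem isSmoothSolenoidal_vectorWave (k : Fin 3 → ℤ) (s : ℝ) (a : E)
    (ha : ∑ i, (k i : ℝ) * a i = 0) : IsSmoothSolenoidal (vectorWave k s a) where
  smooth := contDiff_vectorWave k s a
  periodic := (isPeriodic_wave k s).comp (· • a)
  div_free x := by
    simp only [divergence, fderiv_vectorWave, PiLp.smul_apply, smul_eq_mul, mul_assoc]
    rw [← Finset.mul_sum, ha, mul_zero]

/-- The Fourier coefficients of a vector field. -/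
def waveCoeff (v : L2) (k : Fin 3 → ℤ) (s : ℝ) : E :=
  WithLp.toLp 2 fun j => ∫ x, v x j * wave k s x ∂torusMeasure

/-- The wave of phase `s - π / 2` has gradient `wave k s` times `k`, and `v` is orthogonal to
gradients. Thus the coefficient of a solenoidal field is itself an admissible polarisation. -/
theorem sum_mul_waveCoeff {v : L2} (hv : v ∈ L2sigma) (k : Fin 3 → ℤ) (s : ℝ) :
    ∑ i, (k i : ℝ) * waveCoeff v k s i = 0 := by
  have hw := contDiff_wave k (s - Real.pi / 2)
  have h := (Submodule.mem_orthogonal' _ _).1 hv _ (Submodule.subset_span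
    ⟨wave k (s - Real.pi / 2), hw, isPeriodic_wave k _, rfl⟩)
  rw [inner_toL2_eq_sum] at h
  rw [← h]
  refine Finset.sum_congr rfl fun i _ => ?_
  have hg : ∀ x, gradient (wave k (s - Real.pi / 2)) x i = wave k s x * k i := fun x => by
    have h1 : gradient (wave k (s - Real.pi / 2)) x i
        = ⟪gradient (wave k (s - Real.pi / 2)) x, e i⟫_ℝ := by
      rw [EuclideanSpace.inner_single_right]; simp
    rw [h1, gradient, InnerProductSpace.toDual_symm_apply, fderiv_wave]
    congr 2; ring
  simp_rw [hg, waveCoeff, ← mul_assoc]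
  rw [integral_mul_const, mul_comm]

theorem inner_vectorWave (v : L2) (k : Fin 3 → ℤ) (s : ℝ) (a : E) :
    ⟪v, toL2 (vectorWave k s a) (contDiff_vectorWave k s a).continuous⟫_ℝ
      = ∑ j, a j * waveCoeff v k s j := by
  rw [inner_toL2_eq_sum]
  refine Finset.sum_congr rfl fun i _ => ?_
  simp only [vectorWave, waveCoeff, PiLp.smul_apply, smul_eq_mul, ← mul_assoc]
  rw [integral_mul_const, mul_comm]

/-- The weak gradient is tested with the wave of phase `s + π / 2`; two derivatives reproduce the
wave with sign reversed, whence the factor `|k|²`. -/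
theorem inner_gradField_vectorWave (u : H) (k : Fin 3 → ℤ) (s : ℝ) (a : E) :
    ⟪grad u, toL2 (gradField (vectorWave k s a))
      (continuous_gradField (contDiff_vectorWave k s a))⟫_ℝ
      = (∑ i, (k i : ℝ) ^ 2) * ∑ j, a j * waveCoeff (vel u) k s j := by
  rw [inner_toL2_eq_sum, Fintype.sum_prod_type, Finset.sum_mul]
  refine Finset.sum_congr rfl fun i _ => ?_
  rw [Finset.mul_sum]
  refine Finset.sum_congr rfl fun j _ => ?_
  have h := isWeakGradient_grad u (wave k (s + Real.pi / 2)) (contDiff_wave k _)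
    (isPeriodic_wave k _) i j
  simp only [fderiv_wave, wave_add_pi] at h
  have h1 : ∫ x, vel u x j * (-wave k s x * k i) ∂torusMeasure
      = -((k i : ℝ) * waveCoeff (vel u) k s j) := by
    rw [waveCoeff, ← integral_const_mul, ← integral_neg]
    refine integral_congr_ae (Filter.Eventually.of_forall fun x => ?_)
    simp only; ring
  rw [h1, neg_inj] at h
  have h2 : ∫ x, grad u x (i, j) * gradField (vectorWave k s a) x (i, j) ∂torusMeasure
      = (k i * a j) * ∫ x, grad u x (i, j) * wave k (s + Real.pi / 2) x ∂torusMeasure := by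
    rw [← integral_const_mul]
    refine integral_congr_ae (Filter.Eventually.of_forall fun x => ?_)
    simp only [gradField, fderiv_vectorWave, PiLp.smul_apply, smul_eq_mul]
    ring
  rw [h2, ← h]
  ring

end Waves

/-! ### Density of smooth solenoidal fields in `H`. -/

section Density

theorem gradField_add {f g : E → E} (hf : ContDiff ℝ ∞ f) (hg : ContDiff ℝ ∞ g) :
    gradField (fun x => f x + g x) = fun x => gradField f x + gradField g x := by
  ext x p
  simp [gradField, fderiv_fun_add (hf.differentiable (by simp) x) (hg.differentiable (by simp) x)]

theorem gradField_smul (c : ℝ) {f : E → E} (hf : ContDiff ℝ ∞ f) :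
    gradField (fun x => c • f x) = fun x => c • gradField f x := by
  ext x p
  simp [gradField, fderiv_fun_const_smul (hf.differentiable (by simp) x)]

theorem IsSmoothSolenoidal.add {f g : E → E} (hf : IsSmoothSolenoidal f)
    (hg : IsSmoothSolenoidal g) : IsSmoothSolenoidal fun x => f x + g x where
  smooth := hf.smooth.add hg.smooth
  periodic := hf.periodic.comp₂ hg.periodic (· + ·)
  div_free x := by
    have h := hf.div_free x
    have h' := hg.div_free x
    simp only [divergence] at h h' ⊢
    simp [fderiv_fun_add (hf.smooth.differentiable (by simp) x)
      (hg.smooth.differentiable (by simp) x), Finset.sum_add_distrib, h, h']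

theorem IsSmoothSolenoidal.smul (c : ℝ) {f : E → E} (hf : IsSmoothSolenoidal f) :
    IsSmoothSolenoidal fun x => c • f x where
  smooth := hf.smooth.const_smul c
  periodic := hf.periodic.comp (c • ·)
  div_free x := by
    have h := hf.div_free x
    simp only [divergence] at h ⊢
    simp [fderiv_fun_const_smul (hf.smooth.differentiable (by simp) x), ← Finset.mul_sum, h]

theorem isSmoothSolenoidal_zero : IsSmoothSolenoidal fun _ => 0 where
  smooth := contDiff_const
  periodic _ _ := rfl
  div_free x := by simp [divergence]

theorem ofSmooth_add {f g : E → E} (hf : IsSmoothSolenoidal f) (hg : IsSmoothSolenoidal g) :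
    ofSmooth _ (hf.add hg) = ofSmooth f hf + ofSmooth g hg :=
  H_ext rfl (toL2_congr (gradField_add hf.smooth hg.smooth)
    (continuous_gradField (hf.add hg).smooth)
    ((continuous_gradField hf.smooth).add (continuous_gradField hg.smooth)))

theorem ofSmooth_smul (c : ℝ) {f : E → E} (hf : IsSmoothSolenoidal f) :
    ofSmooth _ (hf.smul c) = c • ofSmooth f hf :=
  H_ext rfl (toL2_congr (gradField_smul c hf.smooth)
    (continuous_gradField (hf.smul c).smooth)
    ((continuous_gradField hf.smooth).const_smul c))

/-- The subspace of `H` formed by the smooth fields. -/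
def smoothH : Submodule ℝ H where
  carrier := {u | ∃ (ψ : E → E) (hψ : IsSmoothSolenoidal ψ), ofSmooth ψ hψ = u}
  add_mem' := by
    rintro _ _ ⟨ψ, hψ, rfl⟩ ⟨χ, hχ, rfl⟩
    exact ⟨_, hψ.add hχ, ofSmooth_add hψ hχ⟩
  zero_mem' := by
    refine ⟨_, isSmoothSolenoidal_zero.smul 0, ?_⟩
    rw [ofSmooth_smul 0 isSmoothSolenoidal_zero, zero_smul]
  smul_mem' := by
    rintro c _ ⟨ψ, hψ, rfl⟩
    exact ⟨_, hψ.smul c, ofSmooth_smul c hψ⟩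

/-- The test field is the plane wave polarised along the coefficient `a` itself, solenoidal by
`sum_mul_waveCoeff`. Its pairing with `u` is `(1 + |k|²) |a|²`. -/
theorem waveCoeff_eq_zero {u : H} (hu : u ∈ smoothHᗮ) (k : Fin 3 → ℤ) (s : ℝ) :
    waveCoeff (vel u) k s = 0 := by
  set a := waveCoeff (vel u) k s with ha
  have hk := sum_mul_waveCoeff (vel_mem u) k s
  have hs := isSmoothSolenoidal_vectorWave k s a hk
  have h := (Submodule.mem_orthogonal' _ _).1 hu (ofSmooth _ hs) ⟨_, hs, rfl⟩
  rw [inner_H, vel_ofSmooth, grad_ofSmooth, inner_vectorWave, inner_gradField_vectorWave,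
    ← ha] at h
  have h1 : (1 + ∑ i, (k i : ℝ) ^ 2) * ∑ j, a j * a j = 0 := by rw [← h]; ring
  have h2 : (0 : ℝ) < 1 + ∑ i, (k i : ℝ) ^ 2 := by positivity
  have h3 : ∑ j, a j * a j = 0 := by
    rcases mul_eq_zero.1 h1 with h | h
    · exact absurd h h2.ne'
    · exact h
  ext j
  have h4 := (Finset.sum_eq_zero_iff_of_nonneg fun j _ => mul_self_nonneg (a j)).1 h3 j
    (Finset.mem_univ j)
  exact mul_self_eq_zero.1 h4

/-- Weak gradients are unique: plane waves, used as test functions, annihilate every entry. -/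
theorem grad_eq_zero_of_vel_eq_zero {u : H} (h : vel u = 0) : grad u = 0 := by
  refine eq_zero_of_waves _ fun p k s => ?_
  have h1 := isWeakGradient_grad u (wave k s) (contDiff_wave k s) (isPeriodic_wave k s) p.1 p.2
  rw [h, integral_coord_mul_eq_inner _ _ (continuous_partial (contDiff_wave k s) p.1),
    inner_zero_left] at h1
  linarith

/-- Smooth fields are dense in `H`. -/
theorem smoothH_topologicalClosure : smoothH.topologicalClosure = ⊤ := by
  rw [Submodule.topologicalClosure_eq_top_iff, Submodule.eq_bot_iff]
  intro u hu
  have h1 : vel u = 0 := eq_zero_of_waves _ fun j k s =>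
    congrArg (fun a : E => a j) (waveCoeff_eq_zero hu k s)
  exact H_ext h1 (grad_eq_zero_of_vel_eq_zero h1)

theorem exists_smooth_near (u : H) {ε : ℝ} (hε : 0 < ε) :
    ∃ (ψ : E → E) (hψ : IsSmoothSolenoidal ψ), ‖ofSmooth ψ hψ - u‖ < ε := by
  have hd : u ∈ closure (smoothH : Set H) := by
    have : u ∈ smoothH.topologicalClosure := by
      rw [smoothH_topologicalClosure]; trivial
    exact this
  obtain ⟨w, ⟨ψ, hψ, rfl⟩, hw⟩ := Metric.mem_closure_iff.1 hd ε hε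
  exact ⟨ψ, hψ, by rwa [← dist_eq_norm, dist_comm]⟩

end Density

/-! ### Comparison of integrals over a ball and over the cell. -/

section Covering

/-- The translation vector of a lattice point in `{-1, 0, 1}³`. -/
def shift (k : Fin 3 → Fin 3) : E := ∑ i, (((k i : ℕ) : ℝ) - 1) • ((2 * Real.pi) • e i)

theorem shift_apply (k : Fin 3 → Fin 3) (i : Fin 3) :
    shift k i = (((k i : ℕ) : ℝ) - 1) * (2 * Real.pi) := by
  unfold shift
  fin_cases i <;> simp [Fin.sum_univ_three]

theorem IsPeriodic.sub_zsmul {F : Type*} {f : E → F} (hf : IsPeriodic f) (i : Fin 3) (n : ℤ)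
    (x : E) : f (x - n • ((2 * Real.pi) • e i)) = f x := (hf i).sub_zsmul_eq n

theorem IsPeriodic.sub_shift {F : Type*} {f : E → F} (hf : IsPeriodic f) (k : Fin 3 → Fin 3)
    (x : E) : f (x - shift k) = f x := by
  have h : ∀ i, (((k i : ℕ) : ℝ) - 1) • ((2 * Real.pi) • e i)
      = (((k i : ℕ) : ℤ) - 1) • ((2 * Real.pi) • e i) := fun i => by
    rw [← Int.cast_smul_eq_zsmul ℝ]; push_cast; rfl
  simp only [shift, Fin.sum_univ_three, h, ← sub_sub]
  rw [hf.sub_zsmul, hf.sub_zsmul, hf.sub_zsmul]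

theorem ball_subset_iUnion :
    Metric.ball (0 : E) (3 * Real.pi) ⊆ ⋃ k, (fun x => x - shift k) ⁻¹' cell := by
  intro x hx
  have hpi := Real.pi_pos
  rw [mem_ball_zero_iff] at hx
  have hk : ∀ i, ∃ k : Fin 3, x i - (((k : ℕ) : ℝ) - 1) * (2 * Real.pi)
      ∈ Ioc (-Real.pi) Real.pi := by
    intro i
    have h1 : |x i| < 3 * Real.pi := (PiLp.norm_apply_le x i).trans_lt hx
    rw [abs_lt] at h1
    by_cases h2 : x i ≤ -Real.pi
    · refine ⟨0, ?_⟩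
      constructor <;> norm_num <;> linarith
    · by_cases h3 : x i ≤ Real.pi
      · refine ⟨1, ?_⟩
        constructor <;> norm_num <;> linarith
      · refine ⟨2, ?_⟩
        constructor <;> norm_num <;> linarith
  choose k hk using hk
  refine mem_iUnion.2 ⟨k, fun i => ?_⟩
  rw [PiLp.sub_apply, shift_apply]
  exact hk i

/-- In the ball each coordinate needs one of the shifts `-2π`, `0`, `2π`, so `3³ = 27` translates of
the cell cover it, and each carries the same integral. -/
theorem lintegral_ball_le {g : E → ENNReal} (hg : IsPeriodic g) :
    ∫⁻ x in Metric.ball (0 : E) (3 * Real.pi), g x ≤ 27 * ∫⁻ x, g x ∂torusMeasure := by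
  have h1 : ∀ k, ∫⁻ x in (fun x => x - shift k) ⁻¹' cell, g x = ∫⁻ x, g x ∂torusMeasure := by
    intro k
    have h := (measurePreserving_sub_right (volume : Measure E) (shift k))
      |>.setLIntegral_comp_preimage_emb (measurableEmbedding_subRight _) g cell
    simp only [hg.sub_shift] at h
    exact h
  calc ∫⁻ x in Metric.ball (0 : E) (3 * Real.pi), g x
      ≤ ∫⁻ x in ⋃ k, (fun x => x - shift k) ⁻¹' cell, g x :=
        lintegral_mono_set ball_subset_iUnion
    _ ≤ ∑' k, ∫⁻ x in (fun x => x - shift k) ⁻¹' cell, g x := lintegral_iUnion_le _ _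
    _ = 27 * ∫⁻ x, g x ∂torusMeasure := by
        simp only [h1, tsum_fintype, Finset.sum_const, nsmul_eq_mul]
        norm_num

theorem eLpNorm_ball_le {h : E → ℝ} (hh : IsPeriodic h) :
    eLpNorm h 2 (volume.restrict (Metric.ball (0 : E) (3 * Real.pi)))
      ≤ 27 ^ (1 / 2 : ℝ) * eLpNorm h 2 torusMeasure := by
  rw [eLpNorm_eq_lintegral_rpow_enorm_toReal (by norm_num) (by norm_num),
    eLpNorm_eq_lintegral_rpow_enorm_toReal (by norm_num) (by norm_num),
    ENNReal.toReal_ofNat, ← ENNReal.mul_rpow_of_nonneg _ _ (by norm_num)]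
  refine ENNReal.rpow_le_rpow ?_ (by norm_num)
  exact lintegral_ball_le (hh.comp fun y => ‖y‖ₑ ^ (2 : ℝ))

end Covering

/-! ### The embedding of `H` into `L⁴`. -/

section Sobolev

theorem norm_fderiv_le_gradField (ψ : E → E) (x : E) :
    ‖fderiv ℝ ψ x‖ ≤ 3 * ‖gradField ψ x‖ := by
  refine ContinuousLinearMap.opNorm_le_bound _ (by positivity) fun v => ?_
  have h1 : ∀ i, ‖fderiv ℝ ψ x (e i)‖ ≤ ‖gradField ψ x‖ := fun i => by
    refine le_of_sq_le_sq ?_ (norm_nonneg _)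
    rw [EuclideanSpace.norm_sq_eq, EuclideanSpace.norm_sq_eq, Fintype.sum_prod_type]
    exact Finset.single_le_sum (f := fun i => ∑ j, ‖gradField ψ x (i, j)‖ ^ 2)
      (fun i _ => by positivity) (Finset.mem_univ i)
  rw [clm_apply_eq_sum]
  calc ‖∑ i, v i • fderiv ℝ ψ x (e i)‖ ≤ ∑ i, ‖v i • fderiv ℝ ψ x (e i)‖ := norm_sum_le _ _
    _ ≤ ∑ _i : Fin 3, ‖v‖ * ‖gradField ψ x‖ := by
        refine Finset.sum_le_sum fun i _ => ?_
        rw [norm_smul]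
        gcongr
        · exact PiLp.norm_apply_le v i
        · exact h1 i
    _ = 3 * ‖gradField ψ x‖ * ‖v‖ := by simp; ring

theorem eLpNorm_eq_ofReal_norm_toL2 {F : Type*} [NormedAddCommGroup F] {f : E → F}
    (hf : Continuous f) : eLpNorm f 2 torusMeasure = ENNReal.ofReal ‖toL2 f hf‖ := by
  rw [toL2, Lp.norm_toLp, ENNReal.ofReal_toReal (memLp_of_continuous hf).2.ne]

/-- A smooth cutoff function equal to one on the cell. -/
def cutoff : ContDiffBump (0 : E) where
  rIn := 2 * Real.pi
  rOut := 5 / 2 * Real.pi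
  rIn_pos := by have := Real.pi_pos; positivity
  rIn_lt_rOut := by have := Real.pi_pos; linarith

theorem exists_bound_fderiv_cutoff : ∃ M : ℝ, 0 ≤ M ∧ ∀ x, ‖fderiv ℝ cutoff x‖ ≤ M := by
  have h := (cutoff.hasCompactSupport.fderiv (𝕜 := ℝ)).exists_bound_of_continuous
    ((cutoff.contDiff (n := 1)).continuous_fderiv (by simp))
  obtain ⟨M, hM⟩ := h
  exact ⟨M, (norm_nonneg _).trans (hM 0), hM⟩

/-- The Sobolev inequality for compactly supported functions is applied to `cutoff • ψ`, which
agrees with `ψ` on the cell. Its derivative is dominated by a periodic function, and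
`eLpNorm_ball_le` brings the norm back to the cell. -/
theorem eLpNorm_four_smooth_le : ∃ C : NNReal, ∀ (ψ : E → E) (hψ : IsSmoothSolenoidal ψ),
    eLpNorm ψ 4 torusMeasure ≤ C * ENNReal.ofReal ‖ofSmooth ψ hψ‖ := by
  obtain ⟨M, hM0, hM⟩ := exists_bound_fderiv_cutoff
  set U := Metric.ball (0 : E) (3 * Real.pi)
  have hpi := Real.pi_pos
  have htsupp : tsupport cutoff ⊆ U := by
    rw [cutoff.tsupport_eq]
    exact Metric.closedBall_subset_ball (by simp only [cutoff]; linarith)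
  set C0 := eLpNormLESNormFDerivOfLeConst E (volume : Measure E) U 2 4
  refine ⟨C0 * (27 ^ (1 / 2 : ℝ) * (Real.toNNReal M + 3)), fun ψ hψ => ?_⟩
  have hc := hψ.smooth.continuous
  have hcd := hψ.smooth.continuous_fderiv (by simp)
  set w : E → E := fun x => cutoff x • ψ x
  have hw : ContDiff ℝ 1 w := cutoff.contDiff.smul (hψ.smooth.of_le (by simp))
  have htw : tsupport w ⊆ tsupport cutoff := tsupport_smul_subset_left _ _
  have h1 : eLpNorm ψ 4 torusMeasure ≤ eLpNorm w 4 volume := by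
    have h2 : eLpNorm ψ 4 torusMeasure = eLpNorm w 4 torusMeasure := by
      refine eLpNorm_congr_ae ?_
      filter_upwards [ae_restrict_mem measurableSet_cell] with x hx
      have : cutoff x = 1 := cutoff.one_of_mem_closedBall (cell_subset hx)
      simp [w, this]
    rw [h2]
    exact eLpNorm_mono_measure _ Measure.restrict_le_self
  have h3 : eLpNorm w 4 volume ≤ C0 * eLpNorm (fderiv ℝ w) 2 volume := by
    -- The exponents are admissible in dimension three: `2 < 3` and `1/2 - 1/3 ≤ 1/4`. The bounded
    -- support allows an exponent below the critical value `6`.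
    have := eLpNorm_le_eLpNorm_fderiv_of_le (volume : Measure E) hw
      ((subset_tsupport w).trans (htw.trans htsupp)) (p := 2) (q := 4) (by norm_num)
      (by simp; norm_num) (by simp; norm_num) Metric.isBounded_ball
    simpa using this
  set b : E → ℝ := fun x => ‖fderiv ℝ ψ x‖ + M * ‖ψ x‖
  have hbp : IsPeriodic b := hψ.periodic.fderiv.comp₂ hψ.periodic fun A y => ‖A‖ + M * ‖y‖
  have h4 : eLpNorm (fderiv ℝ w) 2 volume ≤ eLpNorm b 2 (volume.restrict U) := by
    rw [← eLpNorm_indicator_eq_eLpNorm_restrict Metric.isOpen_ball.measurableSet]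
    refine eLpNorm_mono_real fun x => ?_
    by_cases hx : x ∈ U
    · rw [indicator_of_mem hx]
      have hcut : DifferentiableAt ℝ cutoff x :=
        (cutoff.contDiff (n := 1)).differentiable (by simp) x
      rw [fderiv_fun_smul hcut (hψ.smooth.differentiable (by simp) x)]
      refine (norm_add_le _ _).trans (add_le_add ?_ ?_)
      · rw [norm_smul]
        refine mul_le_of_le_one_left (norm_nonneg _) ?_
        rw [Real.norm_eq_abs, abs_of_nonneg (cutoff.nonneg' x)]
        exact cutoff.le_one
      · rw [ContinuousLinearMap.norm_smulRight_apply]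
        exact mul_le_mul_of_nonneg_right (hM x) (norm_nonneg _)
    · rw [indicator_of_notMem hx, fderiv_of_notMem_tsupport ℝ fun h => hx (htsupp (htw h)),
        norm_zero]
  have h5 : eLpNorm b 2 torusMeasure
      ≤ (Real.toNNReal M + 3 : NNReal) * ENNReal.ofReal ‖ofSmooth ψ hψ‖ := by
    have hbc : Continuous b := by fun_prop
    rw [eLpNorm_eq_ofReal_norm_toL2 hbc]
    have hg := continuous_gradField hψ.smooth
    have hg' : Continuous fun x => 3 * ‖gradField ψ x‖ := by fun_prop
    have hm' : Continuous fun x => M * ‖ψ x‖ := by fun_prop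
    have h6 : ‖toL2 b hbc‖ ≤ 3 * ‖grad (ofSmooth ψ hψ)‖ + M * ‖vel (ofSmooth ψ hψ)‖ := by
      have h7 : ‖toL2 b hbc‖ ≤ ‖toL2 (fun x => 3 * ‖gradField ψ x‖ + M * ‖ψ x‖)
          (hg'.add hm')‖ := by
        refine Lp.norm_le_norm_of_ae_le ?_
        filter_upwards [coeFn_toL2 hbc, coeFn_toL2 (f := fun x => 3 * ‖gradField ψ x‖ + M * ‖ψ x‖)
          (hg'.add hm')] with x hx hx'
        rw [hx, hx', Real.norm_eq_abs, Real.norm_eq_abs, abs_of_nonneg (by positivity),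
          abs_of_nonneg (by positivity)]
        exact add_le_add_left (norm_fderiv_le_gradField ψ x) _
      have h8 : ∀ {F : Type} [NormedAddCommGroup F] (c : ℝ) (_ : 0 ≤ c) (f : E → F)
          (hf : Continuous f) (hf' : Continuous fun x => c * ‖f x‖),
          ‖toL2 (fun x => c * ‖f x‖) hf'‖ ≤ c * ‖toL2 f hf‖ := by
        intro F _ c hc0 f hf hf'
        refine Lp.norm_le_mul_norm_of_ae_le_mul ?_
        filter_upwards [coeFn_toL2 hf, coeFn_toL2 hf'] with x hx hx'
        rw [hx, hx', Real.norm_eq_abs, abs_of_nonneg (by positivity)]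
      rw [toL2_add hg' hm'] at h7
      exact h7.trans ((norm_add_le _ _).trans (add_le_add (h8 3 (by norm_num) _ hg hg')
        (h8 M hM0 _ hc hm')))
    have h9 : ((Real.toNNReal M + 3 : NNReal) : ENNReal) = ENNReal.ofReal (M + 3) := by
      rw [ENNReal.ofReal, Real.toNNReal_add hM0 (by norm_num)]
      simp
    rw [h9, ← ENNReal.ofReal_mul (by positivity)]
    refine ENNReal.ofReal_le_ofReal (h6.trans ?_)
    have := norm_vel_le (ofSmooth ψ hψ)
    have := norm_grad_le (ofSmooth ψ hψ)
    nlinarith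
  calc eLpNorm ψ 4 torusMeasure ≤ C0 * eLpNorm (fderiv ℝ w) 2 volume := h1.trans h3
    _ ≤ C0 * (27 ^ (1 / 2 : ℝ) * ((Real.toNNReal M + 3 : NNReal)
          * ENNReal.ofReal ‖ofSmooth ψ hψ‖)) := by
        gcongr
        exact h4.trans ((eLpNorm_ball_le hbp).trans (by gcongr))
    _ = _ := by
        push_cast
        rw [ENNReal.coe_rpow_of_nonneg _ (by norm_num)]
        push_cast
        ring

/-- The bound passes from smooth fields to all of `H` by Fatou, along a subsequence converging
almost everywhere. -/
theorem eLpNorm_four_le : ∃ C : NNReal, ∀ u : H,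
    eLpNorm (vel u) 4 torusMeasure ≤ C * ENNReal.ofReal ‖u‖ := by
  obtain ⟨C, hC⟩ := eLpNorm_four_smooth_le
  refine ⟨C, fun u => ?_⟩
  choose ψ hψ hn using fun n : ℕ => exists_smooth_near u (Nat.one_div_pos_of_nat (α := ℝ) (n := n))
  set s : ℕ → H := fun n => ofSmooth (ψ n) (hψ n)
  have hs : Filter.Tendsto s Filter.atTop (nhds u) := by
    rw [tendsto_iff_norm_sub_tendsto_zero]
    exact squeeze_zero (fun n => norm_nonneg _) (fun n => (hn n).le)
      tendsto_one_div_add_atTop_nhds_zero_nat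
  have hv : Filter.Tendsto (fun n => vel (s n)) Filter.atTop (nhds (vel u)) :=
    (velL.continuous.tendsto u).comp hs
  obtain ⟨ns, hns, hae⟩ := (tendstoInMeasure_of_tendsto_Lp hv).exists_seq_tendsto_ae
  refine (Lp.eLpNorm_lim_le_liminf_eLpNorm (fun n => (Lp.aestronglyMeasurable _)) _ hae).trans ?_
  have h1 : Filter.Tendsto (fun n => C * ENNReal.ofReal ‖s (ns n)‖) Filter.atTop
      (nhds (C * ENNReal.ofReal ‖u‖)) := by
    refine ENNReal.Tendsto.const_mul ?_ (Or.inr ENNReal.coe_ne_top)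
    exact ENNReal.tendsto_ofReal ((hs.comp hns.tendsto_atTop).norm)
  rw [← h1.liminf_eq]
  refine Filter.liminf_le_liminf (Filter.Eventually.of_forall fun n => ?_)
  exact (eLpNorm_congr_ae (coeFn_toL2 (hψ (ns n)).smooth.continuous)).trans_le
    (hC _ (hψ (ns n)))

instance : Fact ((1 : ENNReal) ≤ 4) := ⟨by norm_num⟩

instance : ENNReal.HolderTriple 4 4 2 := ⟨by
  rw [← ENNReal.toReal_eq_toReal_iff' (by simp) (by simp),
    ENNReal.toReal_add (by simp) (by simp)]
  norm_num⟩

/-- The Sobolev constant of the embedding of `H` into `L⁴`. -/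
def sobolevConst : NNReal := eLpNorm_four_le.choose

theorem memLp_four (u : H) : MemLp (vel u) 4 torusMeasure :=
  ⟨Lp.aestronglyMeasurable _, (eLpNorm_four_le.choose_spec u).trans_lt
    (ENNReal.mul_lt_top ENNReal.coe_lt_top ENNReal.ofReal_lt_top)⟩

/-- The Sobolev embedding of `H` into `L⁴`. -/
def toL4 : H →L[ℝ] Lp E 4 torusMeasure :=
  LinearMap.mkContinuous
    { toFun := fun u => (memLp_four u).toLp (vel u)
      map_add' := fun u v => by
        rw [← MemLp.toLp_add]
        exact MemLp.toLp_congr _ _ (Lp.coeFn_add (vel u) (vel v))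
      map_smul' := fun c u => by
        rw [RingHom.id_apply, ← MemLp.toLp_const_smul]
        exact MemLp.toLp_congr _ _ (Lp.coeFn_smul c (vel u)) }
    sobolevConst fun u => by
      change ‖(memLp_four u).toLp (vel u)‖ ≤ _
      rw [Lp.norm_toLp]
      refine ENNReal.toReal_le_of_le_ofReal (by positivity) ?_
      rw [ENNReal.ofReal_mul (by positivity), ENNReal.ofReal_coe_nnreal]
      exact eLpNorm_four_le.choose_spec u

theorem coeFn_toL4 (u : H) : toL4 u =ᵐ[torusMeasure] vel u := (memLp_four u).coeFn_toLp

end Sobolev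

/-! ### Bounded bilinear and trilinear forms. -/

section BilinearTools

variable {V W : Type*} [NormedAddCommGroup V] [InnerProductSpace ℝ V]
  [NormedAddCommGroup W] [InnerProductSpace ℝ W]

/-- The real inner product as a continuous bilinear map. -/
def innerL (F : Type*) [NormedAddCommGroup F] [InnerProductSpace ℝ F] : F →L[ℝ] F →L[ℝ] ℝ :=
  LinearMap.mkContinuous₂ (LinearMap.mk₂ ℝ (fun x y : F => ⟪x, y⟫_ℝ) inner_add_left
    (fun c x y => by simp [real_inner_smul_left]) inner_add_right
    (fun c x y => by simp [real_inner_smul_right])) 1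
    fun x y => by simpa using norm_inner_le_norm (𝕜 := ℝ) x y

/-- The trilinear form `(u, w, z) ↦ ⟪T u z, G w⟫`. -/
def trilinearOf (T : V →L[ℝ] V →L[ℝ] W) (G : V →L[ℝ] W) : V →L[ℝ] V →L[ℝ] V →L[ℝ] ℝ :=
  let P : W →L[ℝ] V →L[ℝ] ℝ := ((ContinuousLinearMap.compL ℝ V W ℝ).flip G).comp (innerL W)
  (ContinuousLinearMap.flipₗᵢ ℝ V V ℝ).toContinuousLinearEquiv.toContinuousLinearMap.comp
    ((ContinuousLinearMap.compL ℝ V W (V →L[ℝ] ℝ) P).comp T)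

/-- A continuous bilinear form from two inner products. -/
def weightedInner {W' : Type*} [NormedAddCommGroup W'] [InnerProductSpace ℝ W'] (α : ℝ)
    (S : V →L[ℝ] W') (G : V →L[ℝ] W) : V →L[ℝ] V →L[ℝ] ℝ :=
  (innerL W').bilinearComp S S + α • (innerL W).bilinearComp G G

end BilinearTools

/-! ### The quadratic vector field on a Hilbert space with a coercive form. -/

section AbstractField

variable {V : Type*} [NormedAddCommGroup V] [InnerProductSpace ℝ V] [CompleteSpace V]
  {a : V →L[ℝ] V →L[ℝ] ℝ} (ha : IsCoercive a) (B : V →L[ℝ] V →L[ℝ] V →L[ℝ] ℝ) (l : V →L[ℝ] ℝ)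
  (γ : ℝ)

/-- The inverse of the Riesz map of a real Hilbert space as a real-linear map. -/
def dualSymm (V : Type*) [NormedAddCommGroup V] [InnerProductSpace ℝ V] [CompleteSpace V] :
    (V →L[ℝ] ℝ) →L[ℝ] V :=
  LinearMap.mkContinuous
    { toFun := fun l => (InnerProductSpace.toDual ℝ V).symm l
      map_add' := fun l l' => map_add _ _ _
      map_smul' := fun c l => by simp } 1 fun l => by simp

/-- The vector representing a functional with respect to a coercive form. -/
def rieszL : (V →L[ℝ] ℝ) →L[ℝ] V :=
  (ha.continuousLinearEquivOfBilin.symm : V →L[ℝ] V).comp (dualSymm V)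

theorem form_rieszL (l : V →L[ℝ] ℝ) (z : V) : a (rieszL ha l) z = l z := by
  rw [← ha.continuousLinearEquivOfBilin_apply, rieszL,
    ContinuousLinearMap.comp_apply, ContinuousLinearEquiv.coe_coe,
    ContinuousLinearEquiv.apply_symm_apply]
  exact InnerProductSpace.toDual_symm_apply

omit [CompleteSpace V] in
include ha in
theorem eq_of_form_eq {u v : V} (h : ∀ z, a u z = a v z) : u = v := by
  obtain ⟨c, hc, h1⟩ := ha
  by_contra hne
  have h2 := h1 (u - v)
  have h4 : a (u - v) = a u - a v := map_sub a u v
  rw [h4, _root_.sub_apply, h, sub_self] at h2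
  have h3 : 0 < ‖u - v‖ := norm_pos_iff.2 (sub_ne_zero.2 hne)
  have : 0 < c * ‖u - v‖ * ‖u - v‖ := by positivity
  linarith

/-- The vector field `F` with `a (F u, z) = l z - B (u, u, z) - γ a (u, z)`. -/
def field (u : V) : V := rieszL ha (l - B u u) - γ • u

theorem form_field (u z : V) : a (field ha B l γ u) z = l z - B u u z - γ * a u z := by
  rw [field, map_sub, _root_.sub_apply, form_rieszL, map_smul]
  rfl

/-- Splitting the difference of the quadratic terms so that each part is linear in `u - v` yields
the Lipschitz bound on balls. -/
theorem field_sub_field (u v : V) : field ha B l γ u - field ha B l γ v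
    = -rieszL ha (B u (u - v) + B (u - v) v) - γ • (u - v) := by
  have : B u (u - v) + B (u - v) v = B u u - B v v := by
    simp only [map_sub, _root_.sub_apply]; abel
  rw [this]
  simp only [field, map_sub, smul_sub]
  abel

/-- A Lipschitz constant of `field` on the ball of radius `R`. -/
def fieldLip (R : ℝ) : ℝ := ‖rieszL ha‖ * (2 * ‖B‖ * R) + |γ|

theorem fieldLip_nonneg {R : ℝ} (hR : 0 ≤ R) : 0 ≤ fieldLip ha B γ R := by
  unfold fieldLip; positivity

theorem norm_field_sub_field_le {R : ℝ} {u v : V} (hu : ‖u‖ ≤ R) (hv : ‖v‖ ≤ R) :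
    ‖field ha B l γ u - field ha B l γ v‖ ≤ fieldLip ha B γ R * ‖u - v‖ := by
  rw [field_sub_field]
  have h1 : ‖B u (u - v) + B (u - v) v‖ ≤ 2 * ‖B‖ * R * ‖u - v‖ := by
    refine (norm_add_le _ _).trans ?_
    have h2 := B.le_opNorm₂ u (u - v)
    have h3 := B.le_opNorm₂ (u - v) v
    have h4 : ‖B‖ * ‖u‖ * ‖u - v‖ ≤ ‖B‖ * R * ‖u - v‖ := by gcongr
    have h5 : ‖B‖ * ‖u - v‖ * ‖v‖ ≤ ‖B‖ * ‖u - v‖ * R := by gcongr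
    linarith
  calc ‖-rieszL ha (B u (u - v) + B (u - v) v) - γ • (u - v)‖
      ≤ ‖rieszL ha (B u (u - v) + B (u - v) v)‖ + ‖γ • (u - v)‖ := by
        rw [← norm_neg (rieszL ha _)]; exact norm_sub_le _ _
    _ ≤ ‖rieszL ha‖ * (2 * ‖B‖ * R * ‖u - v‖) + |γ| * ‖u - v‖ := by
        rw [norm_smul, Real.norm_eq_abs]
        gcongr
        exact (rieszL ha).le_opNorm_of_le h1
    _ = fieldLip ha B γ R * ‖u - v‖ := by unfold fieldLip; ring

theorem continuous_field : Continuous (field ha B l γ) := by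
  unfold field
  fun_prop

end AbstractField

/-! ### Global existence and uniqueness for the differential equation. -/

section AbstractODE

variable {V : Type*} [NormedAddCommGroup V] [InnerProductSpace ℝ V]

/-- The radial retraction onto the closed ball of radius `R`. -/
def radial (R : ℝ) (u : V) : V := (R / max R ‖u‖) • u

theorem radial_of_le {R : ℝ} (hR : 0 < R) {u : V} (hu : ‖u‖ ≤ R) : radial R u = u := by
  rw [radial, max_eq_left hu, div_self hR.ne', one_smul]

theorem norm_radial_le {R : ℝ} (hR : 0 < R) (u : V) : ‖radial R u‖ ≤ R := by
  have h : 0 < max R ‖u‖ := lt_max_of_lt_left hR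
  rw [radial, norm_smul, Real.norm_eq_abs, abs_of_pos (by positivity), div_mul_eq_mul_div,
    div_le_iff₀ h]
  exact mul_le_mul_of_nonneg_left (le_max_right _ _) hR.le

/-- The difference splits into a contraction of `u - v` and a change of the scaling factor acting on
`v`; each costs at most `‖u - v‖`. -/
theorem norm_radial_sub_le {R : ℝ} (hR : 0 < R) (u v : V) :
    ‖radial R u - radial R v‖ ≤ 2 * ‖u - v‖ := by
  set m := max R ‖u‖
  set n := max R ‖v‖
  have hm : 0 < m := lt_max_of_lt_left hR
  have hn : 0 < n := lt_max_of_lt_left hR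
  have h1 : radial R u - radial R v = (R / m) • (u - v) + (R * (n - m) / (m * n)) • v := by
    have : R * (n - m) / (m * n) = R / m - R / n := by field_simp
    rw [this]
    simp only [radial, smul_sub, sub_smul]
    abel
  have h2 : |n - m| ≤ ‖u - v‖ := by
    refine (abs_max_sub_max_le_max R ‖v‖ R ‖u‖).trans ?_
    rw [sub_self, abs_zero, max_eq_right (abs_nonneg _), norm_sub_rev]
    exact abs_norm_sub_norm_le v u
  have h3 : ‖(R / m) • (u - v)‖ ≤ ‖u - v‖ := by
    rw [norm_smul, Real.norm_eq_abs, abs_of_pos (by positivity)]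
    exact mul_le_of_le_one_left (norm_nonneg _) ((div_le_one hm).2 (le_max_left _ _))
  have h4 : ‖(R * (n - m) / (m * n)) • v‖ ≤ ‖u - v‖ := by
    rw [norm_smul, Real.norm_eq_abs, abs_div, abs_mul, abs_of_pos hR,
      abs_of_pos (mul_pos hm hn), div_mul_eq_mul_div, div_le_iff₀ (mul_pos hm hn)]
    have h5 : R ≤ m := le_max_left _ _
    have h6 : ‖v‖ ≤ n := le_max_right _ _
    calc R * |n - m| * ‖v‖ ≤ m * ‖u - v‖ * n := by gcongr
      _ = ‖u - v‖ * (m * n) := by ring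
  rw [h1]
  calc _ ≤ _ := norm_add_le _ _
    _ ≤ 2 * ‖u - v‖ := by linarith

theorem hasDerivWithinAt_form_self (a : V →L[ℝ] V →L[ℝ] ℝ) (hsymm : ∀ u v, a u v = a v u)
    {w : ℝ → V} {w' : V} {s : Set ℝ} {t : ℝ} (h : HasDerivWithinAt w w' s t) :
    HasDerivWithinAt (fun t => a (w t) (w t)) (2 * a w' (w t)) s t := by
  have h1 := (a.hasFDerivAt.comp_hasDerivWithinAt t h).clm_apply h
  have h2 : 2 * a w' (w t) = a w' (w t) + a (w t) w' := by rw [hsymm (w t) w']; ring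
  rw [h2]
  exact h1

variable [CompleteSpace V] {a : V →L[ℝ] V →L[ℝ] ℝ} (ha : IsCoercive a)
  (hsymm : ∀ u v, a u v = a v u) (B : V →L[ℝ] V →L[ℝ] V →L[ℝ] ℝ) (hB : ∀ u w, B u w w = 0)
  (l : V →L[ℝ] ℝ) {γ : ℝ} (hγ : 0 < γ)

/-- Composition with the retraction makes the field bounded and globally Lipschitz, so
Picard–Lindelöf covers `[0, T]` in one step. -/
theorem exists_solution_truncated {R : ℝ} (hR : 0 < R) (u₀ : V) {T : ℝ} (hT : 0 ≤ T) :
    ∃ u : ℝ → V, u 0 = u₀ ∧ ∀ t ∈ Icc 0 T,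
      HasDerivWithinAt u (field ha B l γ (radial R (u t))) (Icc 0 T) t := by
  set f : V → V := fun u => field ha B l γ (radial R u)
  set K := fieldLip ha B γ R
  have hK : 0 ≤ K := fieldLip_nonneg ha B γ hR.le
  have hlip : ∀ u v, ‖f u - f v‖ ≤ (K * 2) * ‖u - v‖ := fun u v => by
    refine (norm_field_sub_field_le ha B l γ (norm_radial_le hR u) (norm_radial_le hR v)).trans ?_
    rw [mul_assoc]
    exact mul_le_mul_of_nonneg_left (norm_radial_sub_le hR u v) hK
  set L := K * R + ‖field ha B l γ 0‖
  have hL : 0 ≤ L := by positivity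
  have hbound : ∀ u, ‖f u‖ ≤ L := fun u => by
    have h1 := norm_field_sub_field_le ha B l γ (norm_radial_le hR u)
      (v := 0) (by rw [norm_zero]; exact hR.le)
    rw [sub_zero] at h1
    have h2 := mul_le_mul_of_nonneg_left (norm_radial_le hR u) hK
    have h3 := norm_sub_norm_le (f u) (field ha B l γ 0)
    simp only [L]
    linarith
  -- A curve of speed at most `L` stays within distance `L * T` of `u₀`.
  have hPL : IsPicardLindelof (fun _ => f) (tmin := 0) (tmax := T) ⟨0, left_mem_Icc.2 hT⟩ u₀
      (L * T).toNNReal 0 L.toNNReal (K * 2).toNNReal :=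
    { lipschitzOnWith := fun t _ => (LipschitzWith.of_dist_le_mul fun u v => by
        rw [dist_eq_norm, dist_eq_norm, Real.coe_toNNReal _ (by positivity)]
        exact hlip u v).lipschitzOnWith
      continuousOn := fun _ _ => continuousOn_const
      norm_le := fun _ _ u _ => by
        rw [Real.coe_toNNReal _ hL]
        exact hbound u
      mul_max_le := by
        rw [Real.coe_toNNReal _ hL, Real.coe_toNNReal _ (by positivity)]
        simp [hT] }
  exact hPL.exists_eq_forall_mem_Icc_hasDerivWithinAt₀

include hB in
theorem form_field_self (u : V) : a (field ha B l γ u) u = l u - γ * a u u := by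
  rw [form_field, hB, sub_zero]

include hB hγ in
-- The energy production is bounded independently of `R`, so `R` can be fixed after the energy bound
-- is known. Inside the ball the quadratic damping absorbs the forcing. Outside, the quantity is a
-- positive multiple of its value at the retracted point of norm `R`, where damping already
-- dominates.
theorem exists_form_field_radial_le : ∃ C R₀ : ℝ, 0 ≤ C ∧ ∀ R, 0 < R → R₀ ≤ R → ∀ u,
    a (field ha B l γ (radial R u)) u ≤ C := by
  obtain ⟨c, hc, hcoer⟩ := id ha
  -- With `r = ‖w‖`, these are the maximum and the positive zero of `‖l‖ r - γ c r²`.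
  refine ⟨‖l‖ ^ 2 / (4 * (γ * c)), ‖l‖ / (γ * c), by positivity, fun R hR hR₀ u => ?_⟩
  have hgc : 0 < γ * c := by positivity
  have key : ∀ w, a (field ha B l γ w) w ≤ ‖l‖ * ‖w‖ - γ * c * ‖w‖ ^ 2 := fun w => by
    rw [form_field_self ha B hB]
    have h1 : l w ≤ ‖l‖ * ‖w‖ := (le_abs_self _).trans (l.le_opNorm w)
    have h2 := mul_le_mul_of_nonneg_left (hcoer w) hγ.le
    nlinarith
  by_cases hu : ‖u‖ ≤ R
  · rw [radial_of_le hR hu]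
    refine (key u).trans ?_
    rw [le_div_iff₀ (by positivity)]
    nlinarith [sq_nonneg (‖l‖ - 2 * (γ * c) * ‖u‖)]
  · push Not at hu
    have hm : max R ‖u‖ = ‖u‖ := max_eq_right hu.le
    have hu0 : 0 < ‖u‖ := hR.trans hu
    have h1 : u = (‖u‖ / R) • radial R u := by
      rw [radial, hm, smul_smul, div_mul_div_cancel₀ hR.ne', div_self hu0.ne', one_smul]
    have h2 : ‖radial R u‖ = R := by
      rw [radial, hm, norm_smul, Real.norm_eq_abs, abs_of_pos (by positivity),
        div_mul_cancel₀ _ hu0.ne']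
    have h3 : a (field ha B l γ (radial R u)) (radial R u) ≤ 0 := by
      refine (key _).trans ?_
      rw [h2]
      rw [div_le_iff₀ hgc] at hR₀
      nlinarith
    have h4 : a (field ha B l γ (radial R u)) u
        = (‖u‖ / R) * a (field ha B l γ (radial R u)) (radial R u) :=
      (congrArg (fun z => a (field ha B l γ (radial R u)) z) h1).trans (by simp)
    rw [h4]
    refine (mul_nonpos_of_nonneg_of_nonpos (by positivity) h3).trans (by positivity)

theorem HasDerivWithinAt.Ici_of_Icc {W : Type*} [NormedAddCommGroup W] [NormedSpace ℝ W]
    {u : ℝ → W} {u' : W} {b T t : ℝ} (h : HasDerivWithinAt u u' (Icc b T) t)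
    (ht : t ∈ Ico b T) : HasDerivWithinAt u u' (Ici t) t :=
  h.mono_of_mem_nhdsWithin (Icc_mem_nhdsGE_of_mem ht)

include hsymm hB hγ in
-- The energy grows at most linearly, at a rate independent of the truncation. For `R` large the
-- truncated solution never leaves the ball and solves the original equation.
theorem exists_solution_Icc (u₀ : V) {T : ℝ} (hT : 0 ≤ T) :
    ∃ u : ℝ → V, u 0 = u₀ ∧ ∀ t ∈ Icc 0 T,
      HasDerivWithinAt u (field ha B l γ (u t)) (Icc 0 T) t := by
  obtain ⟨C, R₀, hC, hfield⟩ := exists_form_field_radial_le ha B hB l hγ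
  obtain ⟨c, hc, hcoer⟩ := id ha
  set M := (|a u₀ u₀| + 2 * C * T) / c
  have hM : 0 ≤ M := by positivity
  -- The summand `1` lets `‖u t‖ ^ 2 ≤ M` imply `‖u t‖ ≤ R` without a square root.
  set R := max R₀ (M + 1)
  have hMR : M + 1 ≤ R := le_max_right _ _
  have hR : 0 < R := by linarith
  obtain ⟨u, hu0, hu⟩ := exists_solution_truncated (γ := γ) ha B l hR u₀ hT
  refine ⟨u, hu0, fun t ht => ?_⟩
  have hcont : ContinuousOn u (Icc 0 T) := fun t ht => (hu t ht).continuousWithinAt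
  have hq : ∀ t ∈ Icc 0 T, a (u t) (u t) ≤ |a u₀ u₀| + 2 * C * t := by
    refine image_le_of_deriv_right_le_deriv_boundary (f := fun t => a (u t) (u t))
      (f' := fun t => 2 * a (field ha B l γ (radial R (u t))) (u t)) (B' := fun _ => 2 * C)
      ?_ ?_ ?_ ?_ ?_ ?_
    · exact fun t ht => (hasDerivWithinAt_form_self a hsymm (hu t ht)).continuousWithinAt
    · exact fun t ht => HasDerivWithinAt.Ici_of_Icc
        (hasDerivWithinAt_form_self a hsymm (hu t (Ico_subset_Icc_self ht))) ht
    · simp only [hu0, mul_zero, add_zero]; exact le_abs_self _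
    · fun_prop
    · intro t _
      have := ((hasDerivAt_id t).const_mul (2 * C)).const_add (|a u₀ u₀|)
      simpa using this.hasDerivWithinAt
    · intro t _
      have := hfield R hR (le_max_left _ _) (u t)
      linarith
  have hle : ‖u t‖ ≤ R := by
    have h1 := (hcoer (u t)).trans (hq t ht)
    have h2 : 2 * C * t ≤ 2 * C * T := by
      have := ht.2
      gcongr
    have h3 : ‖u t‖ ^ 2 ≤ M := by
      rw [le_div_iff₀ hc]; nlinarith
    nlinarith [norm_nonneg (u t)]
  have := hu t ht
  rwa [radial_of_le hR hle] at this

/-- On a compact interval both solutions stay in a common ball, where the field is Lipschitz. -/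
theorem solution_unique_Icc {u v : ℝ → V} {T : ℝ}
    (hu : ∀ t ∈ Icc 0 T, HasDerivWithinAt u (field ha B l γ (u t)) (Icc 0 T) t)
    (hv : ∀ t ∈ Icc 0 T, HasDerivWithinAt v (field ha B l γ (v t)) (Icc 0 T) t)
    (h0 : u 0 = v 0) : EqOn u v (Icc 0 T) := by
  have hcu : ContinuousOn u (Icc 0 T) := fun t ht => (hu t ht).continuousWithinAt
  have hcv : ContinuousOn v (Icc 0 T) := fun t ht => (hv t ht).continuousWithinAt
  obtain ⟨R, hR⟩ := isCompact_Icc.exists_bound_of_continuousOn hcu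
  obtain ⟨R', hR'⟩ := isCompact_Icc.exists_bound_of_continuousOn hcv
  set M := max (max R R') 0
  have hM : 0 ≤ M := le_max_right _ _
  refine ODE_solution_unique_of_mem_Icc_right (v := fun _ => field ha B l γ)
    (s := fun _ => Metric.closedBall 0 M) (K := (fieldLip ha B γ M).toNNReal) ?_ hcu
    (fun t ht => HasDerivWithinAt.Ici_of_Icc (hu t (Ico_subset_Icc_self ht)) ht) ?_ hcv
    (fun t ht => HasDerivWithinAt.Ici_of_Icc (hv t (Ico_subset_Icc_self ht)) ht) ?_ h0
  · intro t _
    refine LipschitzOnWith.of_dist_le_mul fun x hx y hy => ?_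
    rw [dist_eq_norm, dist_eq_norm, Real.coe_toNNReal _ (fieldLip_nonneg ha B γ hM)]
    exact norm_field_sub_field_le ha B l γ (mem_closedBall_zero_iff.1 hx)
      (mem_closedBall_zero_iff.1 hy)
  · intro t ht
    rw [mem_closedBall_zero_iff]
    exact (hR t (Ico_subset_Icc_self ht)).trans ((le_max_left _ _).trans (le_max_left _ _))
  · intro t ht
    rw [mem_closedBall_zero_iff]
    exact (hR' t (Ico_subset_Icc_self ht)).trans ((le_max_right _ _).trans (le_max_left _ _))

theorem solution_unique {u v : ℝ → V}
    (hu : ∀ t, 0 ≤ t → HasDerivWithinAt u (field ha B l γ (u t)) (Ici 0) t)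
    (hv : ∀ t, 0 ≤ t → HasDerivWithinAt v (field ha B l γ (v t)) (Ici 0) t)
    (h0 : u 0 = v 0) : EqOn u v (Ici 0) := fun t ht =>
  solution_unique_Icc ha B l (T := t) (fun s hs => (hu s hs.1).mono Icc_subset_Ici_self)
    (fun s hs => (hv s hs.1).mono Icc_subset_Ici_self) h0 (right_mem_Icc.2 ht)

include hsymm hB hγ in
theorem exists_solution (u₀ : V) : ∃ u : ℝ → V, u 0 = u₀ ∧ ∀ t, 0 ≤ t →
    HasDerivWithinAt u (field ha B l γ (u t)) (Ici 0) t := by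
  choose U hU0 hU using fun n : ℕ => exists_solution_Icc ha hsymm B hB l hγ u₀
    (T := (n : ℝ) + 1) (by positivity)
  have hagree : ∀ n m : ℕ, n ≤ m → EqOn (U n) (U m) (Icc 0 ((n : ℝ) + 1)) := by
    intro n m hnm
    have hsub : Icc (0 : ℝ) ((n : ℝ) + 1) ⊆ Icc 0 ((m : ℝ) + 1) :=
      Icc_subset_Icc_right (by exact_mod_cast Nat.succ_le_succ hnm)
    exact solution_unique_Icc ha B l (hU n) (fun t ht => (hU m t (hsub ht)).mono hsub)
      (by rw [hU0, hU0])
  -- `U n` lives on `[0, n + 1]`, so the chosen solution extends beyond `t`, and its derivative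
  -- within that interval is a derivative within `[0, ∞)`.
  set u : ℝ → V := fun t => U ⌈t⌉₊ t
  have hu : ∀ n : ℕ, EqOn u (U n) (Icc 0 ((n : ℝ) + 1)) := by
    intro n t ht
    rcases le_total ⌈t⌉₊ n with h | h
    · exact hagree _ _ h ⟨ht.1, (Nat.le_ceil t).trans (by linarith)⟩
    · exact (hagree _ _ h ht).symm
  refine ⟨u, by simp [u, hU0], fun t ht => ?_⟩
  have hmem : t ∈ Icc (0 : ℝ) ((⌈t⌉₊ : ℝ) + 1) := ⟨ht, by linarith [Nat.le_ceil t]⟩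
  have h1 := hU ⌈t⌉₊ t hmem
  rw [← hu _ hmem] at h1
  refine (h1.congr (fun s hs => hu _ hs) (hu _ hmem)).mono_of_mem_nhdsWithin ?_
  have h2 : Iio ((⌈t⌉₊ : ℝ) + 1) ∈ nhds t := Iio_mem_nhds (by linarith [Nat.le_ceil t])
  filter_upwards [self_mem_nhdsWithin, mem_nhdsWithin_of_mem_nhds h2] with s hs hs'
  exact ⟨hs, le_of_lt hs'⟩

end AbstractODE

/-! ### The trilinear form and the scalar product of `𝓗_α` on `H`. -/

section Forms

/-- The tensor product `(a ⊗ b)ᵢⱼ = aᵢ bⱼ`. -/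
def tensorL : E →L[ℝ] E →L[ℝ] Mat :=
  LinearMap.mkContinuous₂ (LinearMap.mk₂ ℝ
    (fun a b : E => (WithLp.toLp 2 fun p : Fin 3 × Fin 3 => a p.1 * b p.2 : Mat))
    (fun a a' b => by ext p; simp [add_mul]) (fun c a b => by ext p; simp [mul_assoc])
    (fun a b b' => by ext p; simp [mul_add]) (fun c a b => by ext p; simp; ring)) 1
    fun a b => by
      rw [one_mul]
      refine le_of_sq_le_sq ?_ (by positivity)
      rw [mul_pow, EuclideanSpace.norm_sq_eq, EuclideanSpace.norm_sq_eq,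
        EuclideanSpace.norm_sq_eq, Fintype.sum_prod_type, Finset.sum_mul_sum]
      simp [mul_pow]

@[simp] theorem tensorL_apply (a b : E) (p : Fin 3 × Fin 3) :
    tensorL a b p = a p.1 * b p.2 := rfl

/-- The tensor product of two elements of `H`, as an `L²` matrix field. -/
def tensorH : H →L[ℝ] H →L[ℝ] L2Mat :=
  (tensorL.holderL torusMeasure 4 4 2).bilinearComp toL4 toL4

theorem coeFn_tensorH (u z : H) :
    tensorH u z =ᵐ[torusMeasure] fun x => tensorL (vel u x) (vel z x) := by
  have h : tensorH u z =ᵐ[torusMeasure] fun x => tensorL (toL4 u x) (toL4 z x) :=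
    tensorL.coeFn_holder (μ := torusMeasure) (p := 4) (q := 4) (r := 2) (toL4 u) (toL4 z)
  filter_upwards [h, coeFn_toL4 u, coeFn_toL4 z] with x hx hu hz
  rw [hx, hu, hz]

/-- The trilinear form `B(u, w, z) = ((u, ∇) w, z)` on `H`. -/
def triL : H →L[ℝ] H →L[ℝ] H →L[ℝ] ℝ := trilinearOf tensorH gradL

/-- Grouping the two undifferentiated factors into one `L²` tensor makes boundedness on `H` a case
of Hölder with exponents `4, 4, 2`. -/
theorem triL_apply (u w z : H) : triL u w z = ⟪tensorH u z, grad w⟫_ℝ := rfl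

theorem triL_eq_integral (u w z : H) : triL u w z
    = ∫ x, ∑ i, ∑ j, vel u x i * grad w x (i, j) * vel z x j ∂torusMeasure := by
  rw [triL_apply, L2.inner_def]
  refine integral_congr_ae ?_
  filter_upwards [coeFn_tensorH u z] with x hx
  rw [hx, PiLp.inner_apply, Fintype.sum_prod_type]
  refine Finset.sum_congr rfl fun i _ => Finset.sum_congr rfl fun j _ => ?_
  simp only [tensorL_apply, RCLike.inner_apply, conj_trivial]
  ring

theorem convection_eq (u : H) {ψ : E → E} (hψ : IsSmoothSolenoidal ψ) :
    convection u ψ = triL u u (ofSmooth ψ hψ) := by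
  rw [triL_eq_integral, convection]
  refine integral_congr_ae ?_
  filter_upwards [coeFn_toL2 hψ.smooth.continuous] with x hx
  rw [vel_ofSmooth, hx]

theorem triL_ofSmooth_eq (u z : H) {ψ : E → E} (hψ : IsSmoothSolenoidal ψ) :
    triL u (ofSmooth ψ hψ) z
      = ∫ x, ⟪transport (vel u) ψ x, vel z x⟫_ℝ ∂torusMeasure := by
  rw [triL_eq_integral]
  refine integral_congr_ae ?_
  filter_upwards [coeFn_toL2 (continuous_gradField hψ.smooth)] with x hx
  rw [grad_ofSmooth, hx, transport, clm_apply_eq_sum, sum_inner]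
  refine Finset.sum_congr rfl fun i _ => ?_
  rw [real_inner_smul_left, PiLp.inner_apply, Finset.mul_sum]
  refine Finset.sum_congr rfl fun j _ => ?_
  simp only [gradField, RCLike.inner_apply, conj_trivial]
  ring

/-- Pointwise `((u, ∇)ψ) · ψ = u · ∇(|ψ|² / 2)`, and `u` is orthogonal to gradients of smooth
periodic functions. -/
theorem triL_ofSmooth_self (u : H) {ψ : E → E} (hψ : IsSmoothSolenoidal ψ) :
    triL u (ofSmooth ψ hψ) (ofSmooth ψ hψ) = 0 := by
  set χ : E → ℝ := fun x => 1 / 2 * ‖ψ x‖ ^ 2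
  have hs : ContDiff ℝ ∞ χ := contDiff_const.mul (hψ.smooth.norm_sq ℝ)
  have hp : IsPeriodic χ := hψ.periodic.comp fun y => 1 / 2 * ‖y‖ ^ 2
  have h := (Submodule.mem_orthogonal' _ _).1 (vel_mem u) _
    (Submodule.subset_span ⟨χ, hs, hp, rfl⟩)
  rw [inner_toL2] at h
  rw [← h, triL_ofSmooth_eq]
  refine integral_congr_ae ?_
  filter_upwards [coeFn_toL2 hψ.smooth.continuous] with x hx
  rw [vel_ofSmooth, hx, real_inner_comm _ (vel u x), gradient,
    InnerProductSpace.toDual_symm_apply, transport]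
  have h1 := (((hψ.smooth.differentiable (by simp) x).hasFDerivAt).norm_sq).const_mul (1 / 2 : ℝ)
  rw [HasFDerivAt.fderiv (f := χ) h1]
  simp [real_inner_comm]

/-- The transport term is skew-symmetric. -/
theorem triL_self_right (u w : H) : triL u w w = 0 := by
  have hcl : IsClosed {w : H | triL u w w = 0} := isClosed_eq (by fun_prop) continuous_const
  have hd : w ∈ closure (smoothH : Set H) := by
    have : w ∈ smoothH.topologicalClosure := by
      rw [smoothH_topologicalClosure]; trivial
    exact this
  refine closure_minimal ?_ hcl hd
  rintro _ ⟨ψ, hψ, rfl⟩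
  exact triL_ofSmooth_self u hψ

/-- The scalar product of `𝓗_α` as a continuous bilinear form on `H`. -/
def formL (α : ℝ) : H →L[ℝ] H →L[ℝ] ℝ := weightedInner α velL gradL

theorem formL_apply (α : ℝ) (u v : H) :
    formL α u v = innerH α (vel u) (grad u) (vel v) (grad v) := rfl

theorem formL_self (α : ℝ) (u : H) : formL α u u = normSq α (vel u) (grad u) := by
  rw [formL_apply, innerH, normSq, real_inner_self_eq_norm_sq, real_inner_self_eq_norm_sq]

theorem formL_comm (α : ℝ) (u v : H) : formL α u v = formL α v u := by
  rw [formL_apply, formL_apply, innerH, innerH, real_inner_comm, real_inner_comm (grad u)]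

theorem min_mul_sq_le_formL (α : ℝ) (u : H) : min 1 α * ‖u‖ ^ 2 ≤ formL α u u := by
  rw [formL_self, normSq, norm_sq_H]
  have h1 : min 1 α ≤ 1 := min_le_left _ _
  have h2 : min 1 α ≤ α := min_le_right _ _
  nlinarith [mul_le_mul_of_nonneg_right h1 (sq_nonneg ‖vel u‖),
    mul_le_mul_of_nonneg_right h2 (sq_nonneg ‖grad u‖)]

theorem isCoercive_formL {α : ℝ} (hα : 0 < α) : IsCoercive (formL α) :=
  ⟨min 1 α, lt_min one_pos hα, fun u => by
    have := min_mul_sq_le_formL α u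
    rwa [sq, ← mul_assoc] at this⟩

/-- The functional `v ↦ (g, v)` on `H`. -/
def forcing (g : L2) : H →L[ℝ] ℝ := (innerL L2 g).comp velL

theorem forcing_apply (g : L2) (v : H) : forcing g v = ⟪g, vel v⟫_ℝ := rfl

end Forms

/-! ### Pairings of the Laplacian and of the Leray projector with elements of `H`. -/

section LaplacianPairing

theorem contDiff_partial_coord {ψ : E → E} (hψ : ContDiff ℝ ∞ ψ) (i j : Fin 3) :
    ContDiff ℝ ∞ fun x => fderiv ℝ ψ x (e i) j := by
  have h : ContDiff ℝ ∞ (fderiv ℝ ψ) := hψ.fderiv_right (by simp)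
  fun_prop

theorem laplacian_coord {ψ : E → E} (hψ : ContDiff ℝ ∞ ψ) (x : E) (j : Fin 3) :
    (Δ ψ) x j = ∑ i, fderiv ℝ (fun y => fderiv ℝ ψ y (e i) j) x (e i) := by
  rw [InnerProductSpace.laplacian_eq_iteratedFDeriv_orthonormalBasis ψ
    (EuclideanSpace.basisFun (Fin 3) ℝ)]
  simp only [WithLp.ofLp_sum, Finset.sum_apply]
  refine Finset.sum_congr rfl fun i _ => ?_
  have h : ContDiff ℝ ∞ (fderiv ℝ ψ) := hψ.fderiv_right (by simp)
  have h1 := (h.differentiable (by simp) x).hasFDerivAt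
  have h2 := (EuclideanSpace.proj (𝕜 := ℝ) j : E →L[ℝ] ℝ).hasFDerivAt.comp x
    (h1.clm_apply (hasFDerivAt_const (e i) x))
  rw [HasFDerivAt.fderiv (f := fun y => fderiv ℝ ψ y (e i) j) h2, iteratedFDeriv_two_apply]
  simp

/-- The defining identity of the weak gradient of `z`, tested with the smooth periodic functions
`∂ᵢψⱼ`. -/
theorem inner_laplacian {ψ : E → E} (hψ : IsSmoothSolenoidal ψ) (z : H) :
    ⟪toL2 (Δ ψ) (continuous_laplacian hψ.smooth), vel z⟫_ℝ
      = -⟪grad (ofSmooth ψ hψ), grad z⟫_ℝ := by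
  rw [real_inner_comm, real_inner_comm (grad z), grad_ofSmooth, inner_toL2_eq_sum,
    inner_toL2_eq_sum, Fintype.sum_prod_type_right, ← Finset.sum_neg_distrib]
  refine Finset.sum_congr rfl fun j _ => ?_
  have hs := fun i => contDiff_partial_coord hψ.smooth i j
  simp_rw [laplacian_coord hψ.smooth, Finset.mul_sum]
  rw [integral_finsetSum _ fun i _ => integrable_coord_mul _ _ (continuous_partial (hs i) i),
    ← Finset.sum_neg_distrib]
  refine Finset.sum_congr rfl fun i _ => ?_
  exact isWeakGradient_grad z _ (hs i) (hψ.periodic.fderiv.comp fun A => A (e i) j) i j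

theorem inner_sub_laplacian (α : ℝ) {ψ : E → E} (hψ : IsSmoothSolenoidal ψ) (z : H) :
    ⟪toL2 ψ hψ.smooth.continuous - α • toL2 (Δ ψ) (continuous_laplacian hψ.smooth), vel z⟫_ℝ
      = formL α (ofSmooth ψ hψ) z := by
  rw [inner_sub_left, real_inner_smul_left, inner_laplacian hψ, formL_apply, innerH, vel_ofSmooth]
  ring

/-- The projector is self-adjoint and fixes solenoidal fields. -/
theorem inner_leray (w : L2) (z : H) : ⟪leray w, vel z⟫_ℝ = ⟪w, vel z⟫_ℝ := by
  rw [leray, Submodule.inner_starProjection_left_eq_right,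
    Submodule.starProjection_eq_self_iff.2 (vel_mem z)]

end LaplacianPairing

/-! ### Time differentiation of curves with values in `L²` and in `H`. -/

section TimeDependent

variable {W : Type*} [NormedAddCommGroup W]

theorem continuous_slice {F : ℝ → E → W} (hF : Continuous (Function.uncurry F)) (t : ℝ) :
    Continuous (F t) := hF.comp (Continuous.prodMk_right t)

/-- A jointly continuous function, as a curve of continuous functions on a ball around the cell. -/
def curveOnBall {F : ℝ → E → W} (hF : Continuous (Function.uncurry F)) :
    C(ℝ, C(Metric.closedBall (0 : E) (2 * Real.pi), W)) :=
  ContinuousMap.curry ⟨fun p : ℝ × Metric.closedBall (0 : E) (2 * Real.pi) => F p.1 p.2,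
    hF.comp (continuous_fst.prodMk (continuous_subtype_val.comp continuous_snd))⟩

instance : CompactSpace (Metric.closedBall (0 : E) (2 * Real.pi)) :=
  isCompact_iff_compactSpace.1 (isCompact_closedBall _ _)

theorem norm_sub_le_curveOnBall {F : ℝ → E → W} (hF : Continuous (Function.uncurry F)) (s t : ℝ)
    {x : E} (hx : x ∈ cell) : ‖F s x - F t x‖ ≤ ‖curveOnBall hF s - curveOnBall hF t‖ :=
  (curveOnBall hF s - curveOnBall hF t).norm_coe_le_norm ⟨x, cell_subset hx⟩

/-- Compactness makes `F'` continuous in time uniformly over the cell. The mean value inequality at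
each `x` then bounds the remainder uniformly, hence in `L²`. -/
theorem hasDerivAt_toL2_slice [NormedSpace ℝ W] {F F' : ℝ → E → W}
    (hF : Continuous (Function.uncurry F)) (hF' : Continuous (Function.uncurry F'))
    (hd : ∀ t x, HasDerivAt (fun s => F s x) (F' t x) t) (t : ℝ) :
    HasDerivAt (fun t => toL2 (F t) (continuous_slice hF t))
      (toL2 (F' t) (continuous_slice hF' t)) t := by
  rw [hasDerivAt_iff_isLittleO, Asymptotics.isLittleO_iff]
  intro c hc
  have hv := volConst_nonneg
  -- The summand `1` keeps the denominator positive.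
  set c' := c / (volConst + 1)
  have hc' : 0 < c' := by positivity
  have h := (curveOnBall hF').continuous.tendsto t
  rw [tendsto_iff_norm_sub_tendsto_zero] at h
  obtain ⟨δ, hδ, hball⟩ := Metric.eventually_nhds_iff_ball.1 (h.eventually_lt_const hc')
  filter_upwards [Metric.ball_mem_nhds t hδ] with s hs
  have hcs := continuous_slice hF
  have hct := continuous_slice hF' t
  have hpt : ∀ x ∈ cell, ‖F s x - F t x - (s - t) • F' t x‖ ≤ c' * ‖s - t‖ := by
    intro x hx
    have hd' : ∀ r, HasDerivAt (fun r => F r x - r • F' t x) (F' r x - F' t x) r := fun r => by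
      have h2 := (hasDerivAt_id' r).smul_const (F' t x)
      rw [one_smul] at h2
      exact (hd r x).sub h2
    have h1 := (convex_ball t δ).norm_image_sub_le_of_norm_hasDerivWithin_le
      (f := fun r => F r x - r • F' t x) (f' := fun r => F' r x - F' t x) (C := c')
      (fun r _ => (hd' r).hasDerivWithinAt)
      (fun r hr => (norm_sub_le_curveOnBall hF' r t hx).trans (hball r hr).le)
      (Metric.mem_ball_self hδ) hs
    refine le_trans (le_of_eq ?_) h1
    congr 1
    rw [sub_smul]; abel
  have h2 := norm_toL2_le (f := fun x => F s x - F t x - (s - t) • F' t x)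
    (((hcs s).sub (hcs t)).sub (hct.const_smul (s - t))) (by positivity) hpt
  refine h2.trans ?_
  have h3 : volConst * c' ≤ c := by
    simp only [c']
    rw [← mul_div_assoc, div_le_iff₀ (by positivity)]
    nlinarith
  rw [← mul_assoc]
  exact mul_le_mul_of_nonneg_right h3 (norm_nonneg _)

theorem norm_H_le (u : H) : ‖u‖ ≤ ‖vel u‖ + ‖grad u‖ := by
  refine le_of_sq_le_sq ?_ (by positivity)
  rw [norm_sq_H]
  nlinarith [norm_nonneg (vel u), norm_nonneg (grad u)]

theorem hasDerivAt_H {u : ℝ → H} {u' : H} {t : ℝ}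
    (hv : HasDerivAt (fun t => vel (u t)) (vel u') t)
    (hg : HasDerivAt (fun t => grad (u t)) (grad u') t) : HasDerivAt u u' t := by
  rw [hasDerivAt_iff_isLittleO, Asymptotics.isLittleO_iff] at *
  intro c hc
  filter_upwards [hv (half_pos hc), hg (half_pos hc)] with s hs hs'
  refine (norm_H_le _).trans ?_
  have h1 : vel (u s - u t - (s - t) • u') = vel (u s) - vel (u t) - (s - t) • vel u' := rfl
  have h2 : grad (u s - u t - (s - t) • u') = grad (u s) - grad (u t) - (s - t) • grad u' := rfl
  rw [h1, h2]
  calc _ ≤ c / 2 * ‖s - t‖ + c / 2 * ‖s - t‖ := add_le_add hs hs'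
    _ = c * ‖s - t‖ := by ring

end TimeDependent

/-! ### Test fields as differentiable curves in `H`. -/

section TestFields

variable {φ : ℝ → E → E}

theorem IsTestField.isSmoothSolenoidal (hφ : IsTestField φ) (t : ℝ) :
    IsSmoothSolenoidal (φ t) :=
  ⟨hφ.contDiff t, hφ.periodic t, hφ.div_free t⟩

theorem IsTestField.fderiv_slice (hφ : IsTestField φ) (t : ℝ) (x v : E) :
    fderiv ℝ (φ t) x v = fderiv ℝ (Function.uncurry φ) (t, x) (0, v) := by
  have h1 := (hφ.smooth.differentiable (by simp) (t, x)).hasFDerivAt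
  have h2 := h1.comp x ((hasFDerivAt_const t x).prodMk (hasFDerivAt_id x))
  rw [HasFDerivAt.fderiv (f := φ t) h2]
  simp

theorem IsTestField.hasDerivAt (hφ : IsTestField φ) (t : ℝ) (x : E) :
    HasDerivAt (fun s => φ s x) (fderiv ℝ (Function.uncurry φ) (t, x) (1, 0)) t := by
  have h1 := (hφ.smooth.differentiable (by simp) (t, x)).hasFDerivAt
  exact h1.comp_hasDerivAt t ((hasDerivAt_id t).prodMk (hasDerivAt_const t x))

theorem IsTestField.timeDeriv_eq (hφ : IsTestField φ) (t : ℝ) (x : E) :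
    timeDeriv φ t x = fderiv ℝ (Function.uncurry φ) (t, x) (1, 0) :=
  (hφ.hasDerivAt t x).deriv

theorem IsTestField.contDiff_fderiv (hφ : IsTestField φ) :
    ContDiff ℝ ∞ (fderiv ℝ (Function.uncurry φ)) := hφ.smooth.fderiv_right (by simp)

/-- Time and space derivatives commute by symmetry of the second derivative of `φ` on space-time. -/
theorem IsTestField.hasDerivAt_fderiv (hφ : IsTestField φ) (t : ℝ) (x v : E) :
    HasDerivAt (fun s => fderiv ℝ (φ s) x v) (fderiv ℝ (timeDeriv φ t) x v) t := by
  have h1 := (hφ.contDiff_fderiv.differentiable (by simp) (t, x)).hasFDerivAt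
  set D := fderiv ℝ (Function.uncurry φ)
  have h2 : HasDerivAt (fun s => D (s, x) (0, v)) (fderiv ℝ D (t, x) (1, 0) (0, v)) t := by
    have h3 := h1.comp_hasDerivAt t ((hasDerivAt_id t).prodMk (hasDerivAt_const t x))
    exact (ContinuousLinearMap.apply ℝ E ((0, v) : ℝ × E)).hasFDerivAt.comp_hasDerivAt t h3
  have h3 : fderiv ℝ (BardinaEuler.timeDeriv φ t) x v = fderiv ℝ D (t, x) (0, v) (1, 0) := by
    have h4 : BardinaEuler.timeDeriv φ t = fun y => D (t, y) (1, 0) :=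
      funext fun y => hφ.timeDeriv_eq t y
    have h5 := h1.comp x ((hasFDerivAt_const t x).prodMk (hasFDerivAt_id x))
    have h6 := (ContinuousLinearMap.apply ℝ E ((1, 0) : ℝ × E)).hasFDerivAt.comp x h5
    rw [h4, HasFDerivAt.fderiv (f := fun y => D (t, y) (1, 0)) h6]
    rfl
  have h7 : IsSymmSndFDerivAt ℝ (Function.uncurry φ) (t, x) :=
    (hφ.smooth.contDiffAt (x := (t, x))).isSymmSndFDerivAt (by
      rw [minSmoothness_of_isRCLikeNormedField]
      exact WithTop.coe_le_coe.2 (le_top : (2 : ℕ∞) ≤ ⊤))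
  rw [h3, h7.eq (0, v) (1, 0)]
  simp_rw [hφ.fderiv_slice]
  exact h2

theorem IsTestField.timeDeriv (hφ : IsTestField φ) : IsTestField (timeDeriv φ) where
  smooth := by
    have h1 : Function.uncurry (BardinaEuler.timeDeriv φ)
        = fun p => fderiv ℝ (Function.uncurry φ) p (1, 0) :=
      funext fun p => hφ.timeDeriv_eq p.1 p.2
    have h2 := hφ.contDiff_fderiv
    rw [h1]
    fun_prop
  periodic t i x := by
    simp only [BardinaEuler.timeDeriv]
    congr 1
    exact funext fun s => hφ.periodic s i x
  div_free t x := by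
    have h1 : HasDerivAt (fun s => divergence (φ s) x) (divergence (BardinaEuler.timeDeriv φ t) x)
        t := by
      simp only [divergence]
      refine HasDerivAt.fun_sum fun i _ => ?_
      exact (EuclideanSpace.proj (𝕜 := ℝ) i : E →L[ℝ] ℝ).hasFDerivAt.comp_hasDerivAt t
        (hφ.hasDerivAt_fderiv t x (e i))
    simp only [hφ.div_free] at h1
    exact h1.unique (hasDerivAt_const t 0)

/-- A test field as a curve in `H`. -/
def IsTestField.curve (hφ : IsTestField φ) (t : ℝ) : H := ofSmooth (φ t) (hφ.isSmoothSolenoidal t)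

theorem IsTestField.continuous_uncurry_gradField (hφ : IsTestField φ) :
    Continuous (Function.uncurry fun t => gradField (φ t)) := by
  have h1 : (Function.uncurry fun t => gradField (φ t)) = fun q : ℝ × E =>
      (WithLp.toLp 2 fun p : Fin 3 × Fin 3 =>
        fderiv ℝ (Function.uncurry φ) q (0, e p.1) p.2 : Mat) := by
    ext q p
    simp only [Function.uncurry, gradField]
    rw [hφ.fderiv_slice]
  have h2 := hφ.contDiff_fderiv.continuous
  rw [h1]
  fun_prop

theorem IsTestField.hasDerivAt_curve (hφ : IsTestField φ) (t : ℝ) :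
    HasDerivAt hφ.curve (hφ.timeDeriv.curve t) t := by
  refine hasDerivAt_H ?_ ?_
  · exact hasDerivAt_toL2_slice hφ.smooth.continuous hφ.timeDeriv.smooth.continuous
      (fun t x => by rw [hφ.timeDeriv_eq]; exact hφ.hasDerivAt t x) t
  · refine hasDerivAt_toL2_slice hφ.continuous_uncurry_gradField
      hφ.timeDeriv.continuous_uncurry_gradField (fun t x => ?_) t
    refine (PiLp.continuousLinearEquiv 2 ℝ fun _ : Fin 3 × Fin 3 => ℝ).symm.hasFDerivAt
      |>.comp_hasDerivAt t (hasDerivAt_pi.2 fun p => ?_)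
    exact (EuclideanSpace.proj (𝕜 := ℝ) p.2 : E →L[ℝ] ℝ).hasFDerivAt.comp_hasDerivAt t
      (hφ.hasDerivAt_fderiv t x (e p.1))

theorem IsTestField.continuous_curve (hφ : IsTestField φ) : Continuous hφ.curve :=
  continuous_iff_continuousAt.2 fun t => (hφ.hasDerivAt_curve t).continuousAt

theorem distSq_eq (α : ℝ) (v : H) (hφ : IsTestField φ) (t : ℝ) :
    distSq α v hφ t = formL α (v - hφ.curve t) (v - hφ.curve t) := by
  rw [formL_self]; rfl

/-- Tested against `H`, the residual is the defect of the test curve in the differential equation.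
This links the concrete dissipative inequality with the abstract one. -/
theorem inner_residual {α : ℝ} (hα : 0 < α) (γ : ℝ) (g : L2) (hφ : IsTestField φ) (t : ℝ)
    (z : H) : ⟪residual α γ g hφ t, vel z⟫_ℝ
      = formL α (hφ.timeDeriv.curve t
          - field (isCoercive_formL hα) triL (forcing g) γ (hφ.curve t)) z := by
  have h0 : formL α (hφ.timeDeriv.curve t
      - field (isCoercive_formL hα) triL (forcing g) γ (hφ.curve t)) z
      = formL α (hφ.timeDeriv.curve t) z
        - formL α (field (isCoercive_formL hα) triL (forcing g) γ (hφ.curve t)) z := by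
    rw [map_sub]; rfl
  have h1 : ⟪toL2 (transport (φ t) (φ t)) (continuous_transport (hφ.contDiff t)), vel z⟫_ℝ
      = triL (hφ.curve t) (hφ.curve t) z := by
    rw [IsTestField.curve, triL_ofSmooth_eq, real_inner_comm, inner_toL2]
    refine integral_congr_ae ?_
    filter_upwards [coeFn_toL2 (hφ.contDiff t).continuous] with x hx
    rw [vel_ofSmooth, transport, transport, hx, real_inner_comm]
  have h2 : ∀ X₁ X₂ X₃ X₄ Z : L2, ⟪X₁ + X₂ + γ • X₃ - X₄, Z⟫_ℝ
      = ⟪X₁, Z⟫_ℝ + ⟪X₂, Z⟫_ℝ + γ * ⟪X₃, Z⟫_ℝ - ⟪X₄, Z⟫_ℝ := fun X₁ X₂ X₃ X₄ Z => by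
    rw [inner_sub_left, inner_add_left, inner_add_left, real_inner_smul_left]
  have h3 := inner_sub_laplacian α (hφ.isSmoothSolenoidal t) z
  have h4 := inner_sub_laplacian α (hφ.timeDeriv.isSmoothSolenoidal t) z
  rw [residual, h2, inner_leray, inner_leray, h1, h3, h4, h0, form_field, forcing_apply]
  simp only [IsTestField.curve]
  ring

end TestFields

/-! ### Grönwall's inequality. -/

section Gronwall

/-- A Grönwall inequality with a variable rate. -/
theorem le_exp_integral_of_deriv_le {y y' κ h : ℝ → ℝ}
    (hy : ∀ t, 0 ≤ t → HasDerivWithinAt y (y' t) (Ici 0) t) (hκ : Continuous κ)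
    (hh : ContinuousOn h (Ici 0)) (hle : ∀ t, 0 ≤ t → y' t ≤ -2 * κ t * y t - 2 * h t)
    {t : ℝ} (ht : 0 ≤ t) :
    y t ≤ y 0 * Real.exp (-2 * ∫ s in (0 : ℝ)..t, κ s)
      - 2 * ∫ τ in (0 : ℝ)..t, Real.exp (-2 * ∫ s in τ..t, κ s) * h τ := by
  set I : ℝ → ℝ := fun t => ∫ s in (0 : ℝ)..t, κ s
  have hI : ∀ t, HasDerivAt I (κ t) t := fun t =>
    intervalIntegral.integral_hasDerivAt_right (hκ.intervalIntegrable _ _)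
      (hκ.stronglyMeasurableAtFilter _ _) hκ.continuousAt
  have hIc : Continuous I := continuous_iff_continuousAt.2 fun t => (hI t).continuousAt
  set m : ℝ → ℝ := fun t => Real.exp (2 * I t)
  have hm : ∀ t, HasDerivAt m (m t * (2 * κ t)) t := fun t => ((hI t).const_mul 2).exp
  have hmc : Continuous m := Real.continuous_exp.comp (continuous_const.mul hIc)
  -- Extension of `h` by its value at `0`, so that its weighted primitive is differentiable on the
  -- whole line.
  set k : ℝ → ℝ := fun t => h (max 0 t)
  have hk : Continuous k :=
    hh.comp_continuous (by fun_prop) fun t => mem_Ici.2 (le_max_left 0 t)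
  have hkh : ∀ t, 0 ≤ t → k t = h t := fun t ht => by simp only [k, max_eq_right ht]
  set J : ℝ → ℝ := fun t => ∫ s in (0 : ℝ)..t, m s * k s
  have hJ : ∀ t, HasDerivAt J (m t * k t) t := fun t =>
    intervalIntegral.integral_hasDerivAt_right ((hmc.mul hk).intervalIntegrable _ _)
      ((hmc.mul hk).stronglyMeasurableAtFilter _ _) (hmc.mul hk).continuousAt
  have hz : ∀ s, 0 ≤ s → HasDerivWithinAt (fun s => m s * y s + 2 * J s)
      (m s * (2 * κ s) * y s + m s * y' s + 2 * (m s * k s)) (Ici 0) s := fun s hs =>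
    ((hm s).hasDerivWithinAt.mul (hy s hs)).add ((hJ s).const_mul 2).hasDerivWithinAt
  -- With the integrating factor `m`, the left side has nonpositive derivative.
  have key : m t * y t + 2 * J t ≤ y 0 := by
    refine image_le_of_deriv_right_le_deriv_boundary (a := 0) (b := t)
      (f := fun s => m s * y s + 2 * J s)
      (f' := fun s => m s * (2 * κ s) * y s + m s * y' s + 2 * (m s * k s))
      (B := fun _ => y 0) (B' := fun _ => 0)
      (fun s hs => (hz s hs.1).continuousWithinAt.mono Icc_subset_Ici_self)
      (fun s hs => (hz s hs.1).mono (Ici_subset_Ici.2 hs.1)) ?_ continuousOn_const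
      (fun s _ => hasDerivWithinAt_const _ _ _) (fun s hs => ?_) (right_mem_Icc.2 ht)
    · simp [m, I, J]
    · have h1 := hle s hs.1
      rw [hkh s hs.1]
      have h2 : 0 < m s := Real.exp_pos _
      have h3 := mul_le_mul_of_nonneg_left h1 h2.le
      linarith
  have hmul : Real.exp (-2 * I t) * m t = 1 := by
    rw [← Real.exp_add]; simp
  have hint : ∫ τ in (0 : ℝ)..t, Real.exp (-2 * ∫ s in τ..t, κ s) * h τ
      = Real.exp (-2 * I t) * J t := by
    rw [← intervalIntegral.integral_const_mul]
    refine intervalIntegral.integral_congr fun τ hτ => ?_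
    rw [uIcc_of_le ht] at hτ
    have h1 : ∫ s in τ..t, κ s = I t - I τ :=
      (intervalIntegral.integral_interval_sub_left (hκ.intervalIntegrable _ _)
        (hκ.intervalIntegrable _ _)).symm
    rw [h1, hkh τ hτ.1, ← mul_assoc, ← Real.exp_add]
    congr 2
    ring
  rw [hint]
  have h4 := mul_le_mul_of_nonneg_left key (Real.exp_pos (-2 * I t)).le
  have h5 : Real.exp (-2 * I t) * (m t * y t + 2 * J t)
      = y t + 2 * (Real.exp (-2 * I t) * J t) := by
    rw [mul_add, ← mul_assoc, hmul]; ring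
  have h6 : Real.exp (-2 * I t) * y 0 = y 0 * Real.exp (-2 * I t) := mul_comm _ _
  linarith

end Gronwall

/-! ### Bounds and continuity of the growth rate. -/

section Rate

variable {V : Type*} [NormedAddCommGroup V] [InnerProductSpace ℝ V]
  (a : V →L[ℝ] V →L[ℝ] ℝ) (B : V →L[ℝ] V →L[ℝ] V →L[ℝ] ℝ)

/-- The growth rate `sup_z (-B (z, Φ, z)) / a (z, z)`. -/
def rate (Φ : V) : ℝ := ⨆ z : {z : V // z ≠ 0}, (-B z.1 Φ z.1) / a z.1 z.1

variable {a} {c : ℝ} (hc : 0 < c) (hcoer : ∀ u, c * ‖u‖ * ‖u‖ ≤ a u u)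

include hc hcoer

theorem form_pos {z : V} (hz : z ≠ 0) : 0 < a z z := by
  have h : 0 < ‖z‖ := norm_pos_iff.2 hz
  exact (by positivity : 0 < c * ‖z‖ * ‖z‖).trans_le (hcoer z)

theorem abs_quotient_le (Φ : V) {z : V} (hz : z ≠ 0) :
    |(-B z Φ z) / a z z| ≤ ‖B‖ / c * ‖Φ‖ := by
  have h := form_pos hc hcoer hz
  rw [abs_div, abs_neg, abs_of_pos h, div_le_iff₀ h]
  have h1 : |B z Φ z| ≤ ‖B‖ * ‖z‖ * ‖Φ‖ * ‖z‖ := (B z Φ).le_of_opNorm_le (B.le_opNorm₂ z Φ) z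
  calc |B z Φ z| ≤ ‖B‖ * ‖z‖ * ‖Φ‖ * ‖z‖ := h1
    _ = ‖B‖ / c * ‖Φ‖ * (c * ‖z‖ * ‖z‖) := by field_simp
    _ ≤ ‖B‖ / c * ‖Φ‖ * a z z := by
        have := hcoer z
        gcongr

theorem bddAbove_quotient (Φ : V) :
    BddAbove (range fun z : {z : V // z ≠ 0} => (-B z.1 Φ z.1) / a z.1 z.1) :=
  ⟨‖B‖ / c * ‖Φ‖, by
    rintro _ ⟨z, rfl⟩
    exact (le_abs_self _).trans (abs_quotient_le B hc hcoer Φ z.2)⟩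

theorem neg_trilinear_le_rate (Φ z : V) : -B z Φ z ≤ rate a B Φ * a z z := by
  by_cases hz : z = 0
  · simp [hz]
  · rw [← div_le_iff₀ (form_pos hc hcoer hz)]
    exact le_ciSup (bddAbove_quotient B hc hcoer Φ) ⟨z, hz⟩

/-- Each quotient is linear in `Φ` with norm at most `‖B‖ / c`; a supremum of such functionals is
Lipschitz with the same constant. -/
theorem rate_le_add (Φ Ψ : V) : rate a B Φ ≤ rate a B Ψ + ‖B‖ / c * ‖Φ - Ψ‖ := by
  -- In the trivial space the supremum is over the empty set, and equals `0` by convention.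
  rcases isEmpty_or_nonempty {z : V // z ≠ 0} with h | h
  · rw [rate, rate, Real.iSup_of_isEmpty, Real.iSup_of_isEmpty]
    positivity
  · refine ciSup_le fun z => ?_
    have h1 : (-B z.1 Φ z.1) / a z.1 z.1
        = (-B z.1 Ψ z.1) / a z.1 z.1 + (-B z.1 (Φ - Ψ) z.1) / a z.1 z.1 := by
      rw [← add_div, map_sub, _root_.sub_apply]
      congr 1
      ring
    rw [h1]
    exact add_le_add (le_ciSup (bddAbove_quotient B hc hcoer Ψ) z)
      ((le_abs_self _).trans (abs_quotient_le B hc hcoer (Φ - Ψ) z.2))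

theorem continuous_rate : Continuous (rate a B) := by
  have hK : 0 ≤ ‖B‖ / c := by positivity
  refine (LipschitzWith.of_dist_le_mul (K := (‖B‖ / c).toNNReal) fun Φ Ψ => ?_).continuous
  rw [Real.coe_toNNReal _ hK, Real.dist_eq, dist_eq_norm, abs_le]
  have h1 := rate_le_add B hc hcoer Φ Ψ
  have h2 := rate_le_add B hc hcoer Ψ Φ
  rw [norm_sub_rev] at h2
  constructor <;> linarith

theorem abs_rate_le (Φ : V) : |rate a B Φ| ≤ ‖B‖ / c * ‖Φ‖ := by
  have h0 : rate a B 0 = 0 := by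
    have : ∀ z : {z : V // z ≠ 0}, (-B z.1 0 z.1) / a z.1 z.1 = 0 := fun z => by simp
    simp only [rate, this]
    exact Real.iSup_const_zero
  have h1 := rate_le_add B hc hcoer Φ 0
  have h2 := rate_le_add B hc hcoer 0 Φ
  rw [h0, sub_zero] at h1
  rw [h0, zero_sub, norm_neg] at h2
  rw [abs_le]
  constructor <;> linarith

end Rate

/-! ### The relative energy inequality. -/

section Comparison

variable {V : Type*} [NormedAddCommGroup V] [InnerProductSpace ℝ V] [CompleteSpace V]
  {a : V →L[ℝ] V →L[ℝ] ℝ} (ha : IsCoercive a) (hsymm : ∀ u v, a u v = a v u)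
  (B : V →L[ℝ] V →L[ℝ] V →L[ℝ] ℝ) (hB : ∀ u w, B u w w = 0)
  (l : V →L[ℝ] ℝ) (γ : ℝ)

include hB in
-- With `w = u - Φ`, the identity `B u w w = 0` reduces the difference of the nonlinear terms to `B
-- w Φ w`, which is quadratic in `w` and controlled by the rate at `Φ`.
theorem form_field_sub_field_le (u Φ : V) :
    a (field ha B l γ u - field ha B l γ Φ) (u - Φ)
      ≤ -(γ - rate a B Φ) * a (u - Φ) (u - Φ) := by
  obtain ⟨c, hc, hcoer⟩ := id ha
  set w := u - Φ with hw
  have h1 : a (field ha B l γ u - field ha B l γ Φ) w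
      = -(B u u w - B Φ Φ w) - γ * (a u w - a Φ w) := by
    rw [map_sub a, _root_.sub_apply, form_field, form_field]; ring
  have h2 : a u w - a Φ w = a w w := by
    rw [hw, map_sub a, _root_.sub_apply]
  have h3 : B u u w - B Φ Φ w = B w Φ w := by
    have h4 := hB u w
    have h5 : B u w w = B u u w - B u Φ w := by
      rw [hw, map_sub (B u), _root_.sub_apply]
    have h6 : B w Φ w = B u Φ w - B Φ Φ w := by
      rw [hw, map_sub B, _root_.sub_apply, _root_.sub_apply]
    linarith
  rw [h1, h2, h3]
  have := neg_trilinear_le_rate B hc hcoer Φ w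
  linarith

include hsymm hB in
/-- The relative energy inequality for a solution and a smooth curve. -/
theorem relative_energy_le {u : ℝ → V}
    (hu : ∀ t, 0 ≤ t → HasDerivWithinAt u (field ha B l γ (u t)) (Ici 0) t)
    {Φ Φ' : ℝ → V} (hΦ : ∀ t, HasDerivAt Φ (Φ' t) t) (hΦ' : Continuous Φ') {t : ℝ} (ht : 0 ≤ t) :
    a (u t - Φ t) (u t - Φ t)
      ≤ a (u 0 - Φ 0) (u 0 - Φ 0) * Real.exp (-2 * ∫ s in (0 : ℝ)..t, (γ - rate a B (Φ s)))
        - 2 * ∫ τ in (0 : ℝ)..t, Real.exp (-2 * ∫ s in τ..t, (γ - rate a B (Φ s)))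
          * a (Φ' τ - field ha B l γ (Φ τ)) (u τ - Φ τ) := by
  obtain ⟨c, hc, hcoer⟩ := id ha
  have hΦc : Continuous Φ := continuous_iff_continuousAt.2 fun t => (hΦ t).continuousAt
  have huc : ContinuousOn u (Ici 0) := fun t ht => (hu t ht).continuousWithinAt
  have hrate := continuous_rate B hc hcoer
  have hfield := continuous_field ha B l γ
  refine le_exp_integral_of_deriv_le (y := fun t => a (u t - Φ t) (u t - Φ t))
    (y' := fun t => 2 * a (field ha B l γ (u t) - Φ' t) (u t - Φ t))
    (κ := fun s => γ - rate a B (Φ s))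
    (h := fun τ => a (Φ' τ - field ha B l γ (Φ τ)) (u τ - Φ τ)) ?_ (by fun_prop) ?_ ?_ ht
  · exact fun s hs => hasDerivWithinAt_form_self a hsymm ((hu s hs).sub (hΦ s).hasDerivWithinAt)
  · have h1 : ContinuousOn (fun τ => Φ' τ - field ha B l γ (Φ τ)) (Ici 0) :=
      (hΦ'.sub (hfield.comp hΦc)).continuousOn
    exact (a.continuous.comp_continuousOn h1).clm_apply (huc.sub hΦc.continuousOn)
  · intro s _
    have h1 := form_field_sub_field_le ha B hB l γ (u s) (Φ s)
    have h2 : a (field ha B l γ (u s) - Φ' s) (u s - Φ s)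
        = a (field ha B l γ (u s) - field ha B l γ (Φ s)) (u s - Φ s)
          - a (Φ' s - field ha B l γ (Φ s)) (u s - Φ s) := by
      rw [← _root_.sub_apply, ← map_sub a]
      congr 2
      abel
    rw [h2]
    linarith

end Comparison

/-! ### Approximation of `C¹` curves by test curves. -/

section Approximation

variable {V : Type*} [NormedAddCommGroup V] [InnerProductSpace ℝ V]

theorem exists_antiderivative_polynomial (p : Polynomial ℝ) :
    ∃ P : ℝ → ℝ, ContDiff ℝ ∞ P ∧ P 0 = 0 ∧ ∀ t, HasDerivAt P (p.eval t) t := by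
  have hc : Continuous fun t => p.eval t := p.continuous
  have hd : ∀ t, HasDerivAt (fun t => ∫ s in (0 : ℝ)..t, p.eval s) (p.eval t) t := fun t =>
    intervalIntegral.integral_hasDerivAt_right (hc.intervalIntegrable _ _)
      (hc.stronglyMeasurableAtFilter _ _) hc.continuousAt
  refine ⟨_, ?_, by simp, hd⟩
  rw [contDiff_infty_iff_deriv]
  refine ⟨fun t => (hd t).differentiableAt, ?_⟩
  rw [show deriv (fun t => ∫ s in (0 : ℝ)..t, p.eval s) = fun t => p.eval t from
    funext fun t => (hd t).deriv]
  simpa using p.contDiff_aeval (𝕜 := ℝ) ∞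

/-- Bernstein approximation, with the nodal values of `f` moved into `S`. The weights are
nonnegative with sum one, so this move costs no more than the largest nodal error. -/
theorem exists_polynomial_curve_near {S : Set V} (hS : Dense S) {f : ℝ → V} {T : ℝ} (hT : 0 < T)
    (hf : ContinuousOn f (Icc 0 T)) {ε : ℝ} (hε : 0 < ε) :
    ∃ (n : ℕ) (p : Fin n → Polynomial ℝ) (ψ : Fin n → V), (∀ k, ψ k ∈ S) ∧
      ∀ t ∈ Icc 0 T, ‖(∑ k, (p k).eval t • ψ k) - f t‖ ≤ ε := by
  have hmaps : ∀ x : unitInterval, T * (x : ℝ) ∈ Icc 0 T := fun x =>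
    ⟨mul_nonneg hT.le x.2.1, mul_le_of_le_one_right hT.le x.2.2⟩
  set F : C(unitInterval, V) := ⟨fun x => f (T * x),
    hf.comp_continuous (by fun_prop) hmaps⟩
  have hlim := bernsteinApproximation_uniform F
  rw [Metric.tendsto_atTop] at hlim
  obtain ⟨n, hn⟩ := hlim (ε / 2) (half_pos hε)
  have hn := hn n le_rfl
  choose ψ hψS hψ using fun k : Fin (n + 1) => hS.exists_dist_lt
    (F (bernstein.z k)) (half_pos hε)
  refine ⟨n + 1, fun k => (bernsteinPolynomial ℝ n k).comp (Polynomial.C T⁻¹ * Polynomial.X), ψ,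
    hψS, fun t ht => ?_⟩
  set x : unitInterval := ⟨T⁻¹ * t, by
    refine ⟨mul_nonneg (inv_nonneg.2 hT.le) ht.1, ?_⟩
    rw [inv_mul_le_iff₀ hT, mul_one]; exact ht.2⟩ with hx
  have hFx : F x = f t := by
    simp only [F, ContinuousMap.coe_mk, hx]
    rw [mul_inv_cancel_left₀ hT.ne']
  have heval : ∀ k : Fin (n + 1), ((bernsteinPolynomial ℝ n k).comp
      (Polynomial.C T⁻¹ * Polynomial.X)).eval t = bernstein n k x := fun k => by
    simp [bernstein, hx, Polynomial.toContinuousMapOn]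
  simp_rw [heval]
  have h1 : ‖bernsteinApproximation n F x - F x‖ ≤ ε / 2 := by
    have := (ContinuousMap.dist_lt_iff (half_pos hε)).1 hn x
    rw [dist_eq_norm] at this
    exact this.le
  have h2 : ‖(∑ k : Fin (n + 1), bernstein n k x • ψ k) - bernsteinApproximation n F x‖
      ≤ ε / 2 := by
    rw [bernsteinApproximation.apply, ← Finset.sum_sub_distrib]
    simp_rw [← smul_sub]
    calc ‖∑ k : Fin (n + 1), bernstein n k x • (ψ k - F (bernstein.z k))‖
        ≤ ∑ k : Fin (n + 1), bernstein n k x * (ε / 2) := by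
          refine norm_sum_le_of_le _ fun k _ => ?_
          rw [norm_smul, Real.norm_eq_abs, abs_of_nonneg bernstein_nonneg]
          refine mul_le_mul_of_nonneg_left ?_ bernstein_nonneg
          rw [← dist_eq_norm, dist_comm]
          exact (hψ k).le
      _ = ε / 2 := by rw [← Finset.sum_mul, bernstein.probability, one_mul]
  rw [← hFx]
  calc _ = ‖((∑ k : Fin (n + 1), bernstein n k x • ψ k) - bernsteinApproximation n F x)
        + (bernsteinApproximation n F x - F x)‖ := by congr 1; abel
    _ ≤ ε := (norm_add_le _ _).trans (by linarith)

/-- A class of pairs `(Φ, Φ')` of curves, closed under sums and containing the products of a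
smooth scalar function with an element of `S`. -/
structure IsTestClass (S : Set V) (𝒯 : (ℝ → V) → (ℝ → V) → Prop) : Prop where
  zero : 𝒯 (fun _ => 0) (fun _ => 0)
  add : ∀ {Φ Φ' Ψ Ψ'}, 𝒯 Φ Φ' → 𝒯 Ψ Ψ' → 𝒯 (fun t => Φ t + Ψ t) (fun t => Φ' t + Ψ' t)
  smul : ∀ {p p' : ℝ → ℝ} {ψ : V}, ContDiff ℝ ∞ p → (∀ t, HasDerivAt p (p' t) t) → ψ ∈ S →
    𝒯 (fun t => p t • ψ) (fun t => p' t • ψ)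

theorem IsTestClass.sum {S : Set V} {𝒯 : (ℝ → V) → (ℝ → V) → Prop} (h𝒯 : IsTestClass S 𝒯)
    {ι : Type*} (s : Finset ι) {p p' : ι → ℝ → ℝ} {ψ : ι → V} (hp : ∀ k, ContDiff ℝ ∞ (p k))
    (hp' : ∀ k t, HasDerivAt (p k) (p' k t) t) (hψ : ∀ k, ψ k ∈ S) :
    𝒯 (fun t => ∑ k ∈ s, p k t • ψ k) (fun t => ∑ k ∈ s, p' k t • ψ k) := by
  classical
  induction s using Finset.induction_on with
  | empty => simpa using h𝒯.zero
  | insert k s hk ih =>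
    simp_rw [Finset.sum_insert hk]
    exact h𝒯.add (h𝒯.smul (hp k) (hp' k) (hψ k)) ih

/-- The derivative is approximated and then integrated from an element of `S` near `u 0`, which
gives closeness in `C¹`. -/
theorem IsTestClass.exists_near {S : Set V} (hS : Dense S) {𝒯 : (ℝ → V) → (ℝ → V) → Prop}
    (h𝒯 : IsTestClass S 𝒯) {u u' : ℝ → V} {T : ℝ} (hT : 0 < T)
    (hu : ∀ t ∈ Icc 0 T, HasDerivWithinAt u (u' t) (Icc 0 T) t)
    (hu' : ContinuousOn u' (Icc 0 T)) {ε : ℝ} (hε : 0 < ε) :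
    ∃ Φ Φ', 𝒯 Φ Φ' ∧ ∀ t ∈ Icc 0 T, ‖Φ t - u t‖ ≤ ε ∧ ‖Φ' t - u' t‖ ≤ ε := by
  -- The error of `Φ` is at most `δ` at time zero plus `δ * T` from integrating the derivative
  -- error.
  set δ := ε / (1 + T)
  have hδ : 0 < δ := by positivity
  have hδε : δ * (1 + T) = ε := div_mul_cancel₀ _ (by positivity)
  obtain ⟨n, p, ψ, hψS, hp⟩ := exists_polynomial_curve_near hS hT hu' hδ
  obtain ⟨ψ₀, hψ₀S, hψ₀⟩ := hS.exists_dist_lt (u 0) hδ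
  choose P hPs hP0 hPd using fun k => exists_antiderivative_polynomial (p k)
  set Φ : ℝ → V := fun t => (1 : ℝ) • ψ₀ + ∑ k, P k t • ψ k
  set Φ' : ℝ → V := fun t => (0 : ℝ) • ψ₀ + ∑ k, (p k).eval t • ψ k
  have hΦ' : ∀ t ∈ Icc 0 T, ‖Φ' t - u' t‖ ≤ δ := fun t ht => by
    simpa [Φ'] using hp t ht
  have hΦd : ∀ t, HasDerivAt Φ (Φ' t) t := fun t =>
    ((hasDerivAt_const t (1 : ℝ)).smul_const ψ₀).add
      (HasDerivAt.fun_sum fun k _ => (hPd k t).smul_const (ψ k))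
  refine ⟨Φ, Φ', h𝒯.add (h𝒯.smul contDiff_const (fun t => hasDerivAt_const t _) hψ₀S)
    (h𝒯.sum _ hPs hPd hψS), fun t ht => ⟨?_, (hΦ' t ht).trans (by nlinarith)⟩⟩
  have h1 := (convex_Icc 0 T).norm_image_sub_le_of_norm_hasDerivWithin_le
    (f := fun s => Φ s - u s) (fun s hs => (hΦd s).hasDerivWithinAt.sub (hu s hs)) hΦ'
    (left_mem_Icc.2 hT.le) ht
  have h2 : ‖Φ 0 - u 0‖ ≤ δ := by
    have : Φ 0 = ψ₀ := by simp [Φ, hP0]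
    rw [this, ← dist_eq_norm, dist_comm]
    exact hψ₀.le
  rw [sub_zero, Real.norm_eq_abs, abs_of_nonneg ht.1] at h1
  have h3 : δ * t ≤ δ * T := mul_le_mul_of_nonneg_left ht.2 hδ.le
  have h4 := norm_sub_norm_le (Φ t - u t) (Φ 0 - u 0)
  linarith

end Approximation

/-! ### Uniqueness from the energy inequality. -/

section Uniqueness

variable {V : Type*} [NormedAddCommGroup V] [InnerProductSpace ℝ V] [CompleteSpace V]
  {a : V →L[ℝ] V →L[ℝ] ℝ} (ha : IsCoercive a) (B : V →L[ℝ] V →L[ℝ] V →L[ℝ] ℝ)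
  (l : V →L[ℝ] ℝ) (γ : ℝ)

/-- The right-hand side of the relative energy inequality up to time `t`. -/
def energyBound (v Φ Φ' : ℝ → V) (t : ℝ) : ℝ :=
  a (v 0 - Φ 0) (v 0 - Φ 0) * Real.exp (-2 * ∫ s in (0 : ℝ)..t, (γ - rate a B (Φ s)))
    - 2 * ∫ τ in (0 : ℝ)..t, Real.exp (-2 * ∫ s in τ..t, (γ - rate a B (Φ s)))
      * a (Φ' τ - field ha B l γ (Φ τ)) (v τ - Φ τ)

/-- The constant must not depend on `Φ`. Since `Φ` stays in a fixed ball, the rates are uniformly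
bounded. The defect `Φ' - F(Φ)` is of order `ε` because `F` is Lipschitz there, and the initial term
is of order `ε²`. -/
theorem exists_energyBound_le {u v : ℝ → V} {T : ℝ} (hT : 0 ≤ T)
    (huc : ContinuousOn u (Icc 0 T)) {N : ℝ} (hv : ∀ t ∈ Icc 0 T, ‖v t‖ ≤ N) (h0 : v 0 = u 0) :
    ∃ Y : ℝ, ∀ ε, 0 < ε → ε ≤ 1 → ∀ Φ Φ' : ℝ → V,
      (∀ t ∈ Icc 0 T, ‖Φ t - u t‖ ≤ ε ∧ ‖Φ' t - field ha B l γ (u t)‖ ≤ ε) →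
      energyBound ha B l γ v Φ Φ' T ≤ Y * ε := by
  obtain ⟨c, hc, hcoer⟩ := id ha
  obtain ⟨M₀, hM₀⟩ := isCompact_Icc.exists_bound_of_continuousOn huc
  -- The margin `1` absorbs `‖Φ t - u t‖ ≤ ε ≤ 1`, so one ball contains both curves.
  set M := max M₀ 0 + 1
  have hM1 : 1 ≤ M := by linarith [le_max_right M₀ 0]
  have hM : 0 ≤ M := zero_le_one.trans hM1
  have hN : 0 ≤ N := (norm_nonneg _).trans (hv 0 (left_mem_Icc.2 hT))
  set L := fieldLip ha B γ M
  have hL : 0 ≤ L := fieldLip_nonneg ha B γ hM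
  set κ := |γ| + ‖B‖ / c * M
  have hκ : 0 ≤ κ := by positivity
  set X := Real.exp (2 * (κ * T))
  have hX : 0 < X := Real.exp_pos _
  set D := X * (‖a‖ * (1 + L) * (N + M))
  refine ⟨‖a‖ * X + 2 * (D * T), fun ε hε hε1 Φ Φ' hΦ => ?_⟩
  have hu : ∀ t ∈ Icc 0 T, ‖u t‖ ≤ M := fun t ht =>
    (hM₀ t ht).trans (by linarith [le_max_left M₀ 0])
  have hΦM : ∀ t ∈ Icc 0 T, ‖Φ t‖ ≤ M := fun t ht => by
    have h1 := norm_sub_norm_le (Φ t) (u t)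
    have h2 := (hΦ t ht).1
    have h3 := hM₀ t ht
    have h4 := le_max_left M₀ 0
    linarith
  have hexp : ∀ τ ∈ Icc 0 T, Real.exp (-2 * ∫ s in τ..T, (γ - rate a B (Φ s))) ≤ X := by
    intro τ hτ
    refine Real.exp_le_exp.2 ?_
    have h1 : ‖∫ s in τ..T, (γ - rate a B (Φ s))‖ ≤ κ * |T - τ| := by
      refine intervalIntegral.norm_integral_le_of_norm_le_const fun s hs => ?_
      rw [uIoc_of_le hτ.2] at hs
      have hs' : s ∈ Icc 0 T := ⟨hτ.1.trans hs.1.le, hs.2⟩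
      refine (norm_sub_le _ _).trans (add_le_add le_rfl ?_)
      refine (abs_rate_le B hc hcoer (Φ s)).trans ?_
      have := hΦM s hs'
      gcongr
    have h2 : κ * |T - τ| ≤ κ * T := by
      rw [abs_of_nonneg (sub_nonneg.2 hτ.2)]
      have := hτ.1
      gcongr
      linarith
    have h3 := neg_abs_le (∫ s in τ..T, (γ - rate a B (Φ s)))
    rw [Real.norm_eq_abs] at h1
    linarith
  have ha2 : ∀ x y, |a x y| ≤ ‖a‖ * ‖x‖ * ‖y‖ := fun x y => a.le_opNorm₂ x y
  have h0mem : (0 : ℝ) ∈ Icc 0 T := left_mem_Icc.2 hT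
  have hfirst : a (v 0 - Φ 0) (v 0 - Φ 0)
      * Real.exp (-2 * ∫ s in (0 : ℝ)..T, (γ - rate a B (Φ s))) ≤ ‖a‖ * X * ε := by
    have h1 : ‖v 0 - Φ 0‖ ≤ ε := by rw [h0, norm_sub_rev]; exact (hΦ 0 h0mem).1
    have h2 : a (v 0 - Φ 0) (v 0 - Φ 0) ≤ ‖a‖ * ε * ε :=
      (le_abs_self _).trans ((ha2 _ _).trans (by gcongr))
    have h3 : ‖a‖ * ε * ε ≤ ‖a‖ * ε :=
      mul_le_of_le_one_right (by positivity) hε1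
    calc _ ≤ ‖a‖ * ε * X := mul_le_mul (h2.trans h3) (hexp 0 h0mem) (Real.exp_pos _).le
          (by positivity)
      _ = ‖a‖ * X * ε := by ring
  have hsecond : ‖∫ τ in (0 : ℝ)..T, Real.exp (-2 * ∫ s in τ..T, (γ - rate a B (Φ s)))
      * a (Φ' τ - field ha B l γ (Φ τ)) (v τ - Φ τ)‖ ≤ D * ε * |T - 0| := by
    -- A pointwise bound suffices; no regularity of `v` or `Φ'` in time enters.
    refine intervalIntegral.norm_integral_le_of_norm_le_const fun τ hτ => ?_
    rw [uIoc_of_le hT] at hτ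
    have hτ' : τ ∈ Icc 0 T := Ioc_subset_Icc_self hτ
    have h1 : ‖Φ' τ - field ha B l γ (Φ τ)‖ ≤ (1 + L) * ε := by
      have h2 := norm_field_sub_field_le ha B l γ (hu τ hτ') (hΦM τ hτ')
      have h3 := (hΦ τ hτ').2
      have h4 : L * ‖u τ - Φ τ‖ ≤ L * ε := by
        rw [norm_sub_rev]
        exact mul_le_mul_of_nonneg_left (hΦ τ hτ').1 hL
      have h5 := norm_sub_le_norm_sub_add_norm_sub (Φ' τ) (field ha B l γ (u τ))
        (field ha B l γ (Φ τ))
      linarith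
    have h6 : ‖v τ - Φ τ‖ ≤ N + M := (norm_sub_le _ _).trans (add_le_add (hv τ hτ') (hΦM τ hτ'))
    rw [norm_mul, Real.norm_eq_abs, Real.norm_eq_abs, abs_of_pos (Real.exp_pos _)]
    calc _ ≤ X * (‖a‖ * ((1 + L) * ε) * (N + M)) := by
          refine mul_le_mul (hexp τ hτ') ?_ (abs_nonneg _) hX.le
          exact (ha2 _ _).trans (by gcongr)
      _ = D * ε := by simp only [D]; ring
  rw [sub_zero, abs_of_nonneg hT, Real.norm_eq_abs] at hsecond
  have h7 := (abs_le.1 hsecond).1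
  rw [energyBound]
  have h8 : (‖a‖ * X + 2 * (D * T)) * ε = ‖a‖ * X * ε + 2 * (D * ε * T) := by ring
  rw [h8]
  linarith

/-- Test curves `Φ` tending to `u` in `C¹` make the right-hand side vanish, so `v T` is the limit of
`Φ T`, which is `u T`. -/
theorem eq_of_energy_inequality {S : Set V} (hS : Dense S) {𝒯 : (ℝ → V) → (ℝ → V) → Prop}
    (h𝒯 : IsTestClass S 𝒯) {u v : ℝ → V}
    (hu : ∀ t, 0 ≤ t → HasDerivWithinAt u (field ha B l γ (u t)) (Ici 0) t) {T : ℝ} (hT : 0 ≤ T)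
    {N : ℝ} (hv : ∀ t ∈ Icc 0 T, ‖v t‖ ≤ N) (h0 : v 0 = u 0)
    (hineq : ∀ Φ Φ', 𝒯 Φ Φ' → a (v T - Φ T) (v T - Φ T) ≤ energyBound ha B l γ v Φ Φ' T) :
    v T = u T := by
  rcases hT.eq_or_lt with rfl | hTpos
  · exact h0
  obtain ⟨c, hc, hcoer⟩ := id ha
  have huI : ∀ t ∈ Icc 0 T, HasDerivWithinAt u (field ha B l γ (u t)) (Icc 0 T) t := fun t ht =>
    (hu t ht.1).mono Icc_subset_Ici_self
  have huc : ContinuousOn u (Icc 0 T) := fun t ht => (huI t ht).continuousWithinAt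
  obtain ⟨Y, hY⟩ := exists_energyBound_le ha B l γ hT huc hv h0
  -- From `‖v - u‖² ≤ 2 ‖v - Φ‖² + 2 ‖Φ - u‖²` at time `T`, with coercivity in the first term and
  -- `ε² ≤ ε` in the second.
  have hsmall : ∀ ε, 0 < ε → ε ≤ 1 → ‖v T - u T‖ ^ 2 ≤ (2 * (Y / c) + 2) * ε := by
    intro ε hε hε1
    obtain ⟨Φ, Φ', hΦ, hnear⟩ := h𝒯.exists_near hS hTpos huI
      ((continuous_field ha B l γ).comp_continuousOn huc) hε
    have h1 := (hcoer (v T - Φ T)).trans ((hineq Φ Φ' hΦ).trans (hY ε hε hε1 Φ Φ' hnear))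
    have h2 : ‖v T - Φ T‖ ^ 2 ≤ Y / c * ε := by
      rw [div_mul_eq_mul_div, le_div_iff₀ hc]; linarith
    have h3 := (hnear T (right_mem_Icc.2 hT)).1
    have h4 := norm_sub_le_norm_sub_add_norm_sub (v T) (Φ T) (u T)
    have h5 := norm_nonneg (v T - u T)
    have h6 : ε ^ 2 ≤ ε := by nlinarith
    have h7 : ‖Φ T - u T‖ ^ 2 ≤ ε := (pow_le_pow_left₀ (norm_nonneg _) h3 2).trans h6
    have h8 : ‖v T - u T‖ ^ 2 ≤ (‖v T - Φ T‖ + ‖Φ T - u T‖) ^ 2 := pow_le_pow_left₀ h5 h4 2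
    nlinarith [sq_nonneg (‖v T - Φ T‖ - ‖Φ T - u T‖)]
  have hlim : Filter.Tendsto (fun ε : ℝ => (2 * (Y / c) + 2) * ε) (nhdsWithin 0 (Ioi 0))
      (nhds 0) := by
    have : Filter.Tendsto (fun ε : ℝ => (2 * (Y / c) + 2) * ε) (nhds 0)
        (nhds ((2 * (Y / c) + 2) * 0)) := (continuous_const.mul continuous_id).tendsto 0
    rw [mul_zero] at this
    exact this.mono_left nhdsWithin_le_nhds
  have hle : ‖v T - u T‖ ^ 2 ≤ 0 := by
    refine ge_of_tendsto hlim ?_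
    filter_upwards [Ioc_mem_nhdsGT (zero_lt_one' ℝ)] with ε hε
    exact hsmall ε hε.1 hε.2
  have h9 : ‖v T - u T‖ = 0 := by
    have := norm_nonneg (v T - u T)
    nlinarith
  exact sub_eq_zero.1 (norm_eq_zero.1 h9)

end Uniqueness

/-! ### Test fields form an admissible approximating class. -/

section TestClass

theorem dense_smoothH : Dense (smoothH : Set H) := by
  intro u
  have : u ∈ smoothH.topologicalClosure := by
    rw [smoothH_topologicalClosure]; trivial
  exact this

theorem isTestField_add {φ χ : ℝ → E → E} (hφ : IsTestField φ) (hχ : IsTestField χ) :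
    IsTestField fun t x => φ t x + χ t x where
  smooth := hφ.smooth.add hχ.smooth
  periodic t := (hφ.periodic t).comp₂ (hχ.periodic t) (· + ·)
  div_free t := ((hφ.isSmoothSolenoidal t).add (hχ.isSmoothSolenoidal t)).div_free

theorem isTestField_smul {p : ℝ → ℝ} (hp : ContDiff ℝ ∞ p) {ψ : E → E}
    (hψ : IsSmoothSolenoidal ψ) : IsTestField fun t x => p t • ψ x where
  smooth := (hp.comp contDiff_fst).smul (hψ.smooth.comp contDiff_snd)
  periodic t := (hψ.smul (p t)).periodic
  div_free t := (hψ.smul (p t)).div_free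

/-- The pairs of curves in `H` given by a test field and its time derivative. -/
def IsTestCurve (Φ Φ' : ℝ → H) : Prop :=
  ∃ (φ : ℝ → E → E) (hφ : IsTestField φ), hφ.curve = Φ ∧ hφ.timeDeriv.curve = Φ'

/-- Uniqueness of derivatives in `H` identifies the curve of `timeDeriv φ` without computing it. -/
theorem isTestCurve_of_hasDerivAt {φ : ℝ → E → E} (hφ : IsTestField φ) {Φ Φ' : ℝ → H}
    (h : ∀ t, hφ.curve t = Φ t) (h' : ∀ t, HasDerivAt Φ (Φ' t) t) : IsTestCurve Φ Φ' := by
  have h0 : hφ.curve = Φ := funext h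
  refine ⟨φ, hφ, h0, funext fun t => ?_⟩
  have h1 := hφ.hasDerivAt_curve t
  rw [h0] at h1
  exact h1.unique (h' t)

theorem isTestClass_isTestCurve : IsTestClass (smoothH : Set H) IsTestCurve where
  zero := isTestCurve_of_hasDerivAt (isTestField_smul contDiff_const isSmoothSolenoidal_zero)
    (fun t => (ofSmooth_smul 0 isSmoothSolenoidal_zero).trans (zero_smul ℝ _))
    fun t => hasDerivAt_const t 0
  add := by
    rintro _ _ _ _ ⟨φ, hφ, rfl, rfl⟩ ⟨χ, hχ, rfl, rfl⟩
    exact isTestCurve_of_hasDerivAt (isTestField_add hφ hχ)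
      (fun t => ofSmooth_add (hφ.isSmoothSolenoidal t) (hχ.isSmoothSolenoidal t))
      fun t => (hφ.hasDerivAt_curve t).add (hχ.hasDerivAt_curve t)
  smul := by
    rintro p p' _ hp hp' ⟨ψ, hψ, rfl⟩
    exact isTestCurve_of_hasDerivAt (isTestField_smul hp hψ)
      (fun t => ofSmooth_smul (p t) hψ) fun t => (hp' t).smul_const _

theorem growthRate_eq_rate (α : ℝ) {φ : ℝ → E → E} (hφ : IsTestField φ) (t : ℝ) :
    growthRate α φ t = rate (formL α) triL (hφ.curve t) := by
  rw [growthRate, rate]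
  refine iSup_congr fun z => ?_
  rw [IsTestField.curve, triL_ofSmooth_eq, formL_self]

end TestClass

/-! ### Strong and dissipative solutions in terms of the differential equation. -/

section Solutions

variable {α : ℝ} (hα : 0 < α) (γ : ℝ) (g : L2)

/-- The vector field of the equation on `H`. -/
def bardinaField : H → H := field (isCoercive_formL hα) triL (forcing g) γ

/-- The weak formulation at a fixed time is equivalent to the equation in `H`. -/
theorem eq_bardinaField_iff (u u' : H) : u' = bardinaField hα γ g u ↔
    ∀ (ψ : E → E) (hψ : IsSmoothSolenoidal ψ), formL α u' (ofSmooth ψ hψ) + convection u ψ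
      + γ * formL α u (ofSmooth ψ hψ) = ⟪g, vel (ofSmooth ψ hψ)⟫_ℝ := by
  constructor
  · rintro rfl ψ hψ
    rw [bardinaField, form_field, convection_eq u hψ, forcing_apply]
    ring
  · intro h
    refine eq_of_form_eq (isCoercive_formL hα) fun z => ?_
    -- The weak formulation gives equality only on smooth fields; density extends it to all `z`.
    refine congrFun (Continuous.ext_on dense_smoothH (f := fun z => formL α u' z)
      (g := fun z => formL α (bardinaField hα γ g u) z) (formL α u').continuous
      (formL α (bardinaField hα γ g u)).continuous ?_) z
    rintro _ ⟨ψ, hψ, rfl⟩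
    have h1 := h ψ hψ
    rw [convection_eq u hψ] at h1
    simp only
    rw [bardinaField, form_field, forcing_apply]
    linarith

theorem IsStrongSolution.hasDerivWithinAt {u₀ : H} {u : ℝ → H}
    (hu : IsStrongSolution α γ g u₀ u) (t : ℝ) (ht : 0 ≤ t) :
    HasDerivWithinAt u (bardinaField hα γ g (u t)) (Ici 0) t := by
  have h1 : derivWithin u (Ici 0) t = bardinaField hα γ g (u t) :=
    (eq_bardinaField_iff hα γ g _ _).2 fun ψ hψ =>
      hu.equation t ht ψ hψ.smooth hψ.periodic hψ.div_free
  rw [← h1]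
  exact (hu.contDiffOn.differentiableOn (by simp) t ht).hasDerivWithinAt

theorem isStrongSolution_of_hasDerivWithinAt {u : ℝ → H}
    (hu : ∀ t, 0 ≤ t → HasDerivWithinAt u (bardinaField hα γ g (u t)) (Ici 0) t) :
    IsStrongSolution α γ g (u 0) u := by
  have hd : ∀ t, 0 ≤ t → derivWithin u (Ici 0) t = bardinaField hα γ g (u t) := fun t ht =>
    (hu t ht).derivWithin (uniqueDiffOn_Ici 0 t ht)
  have hc : ContinuousOn u (Ici 0) := fun t ht => (hu t ht).continuousWithinAt
  refine ⟨?_, rfl, fun t ht ψ hψ hp hdiv =>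
    (eq_bardinaField_iff hα γ g _ _).1 (hd t ht) ψ ⟨hψ, hp, hdiv⟩⟩
  rw [contDiffOn_one_iff_derivWithin (uniqueDiffOn_Ici 0)]
  refine ⟨fun t ht => (hu t ht).differentiableWithinAt, ?_⟩
  exact ((continuous_field _ _ _ _).comp_continuousOn hc).congr hd

theorem isDissipativeSolution_of_hasDerivWithinAt {u : ℝ → H}
    (hu : ∀ t, 0 ≤ t → HasDerivWithinAt u (bardinaField hα γ g (u t)) (Ici 0) t) :
    IsDissipativeSolution α γ g (u 0) u where
  locallyBounded T := by
    have hc : ContinuousOn u (Icc 0 T) := fun t ht =>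
      (hu t ht.1).continuousWithinAt.mono Icc_subset_Ici_self
    have hf : ContinuousOn (fun t => formL α (u t) (u t)) (Icc 0 T) :=
      ((formL α).continuous.comp_continuousOn hc).clm_apply hc
    obtain ⟨C, hC⟩ := isCompact_Icc.exists_bound_of_continuousOn hf
    exact ⟨C, fun t ht => by
      rw [← formL_self]; exact (le_abs_self _).trans (hC t ht)⟩
  weaklyContinuous l t ht := l.continuous.continuousAt.comp_continuousWithinAt
    (hu t ht).continuousWithinAt
  initial := rfl
  inequality φ hφ t ht := by
    have h := relative_energy_le (isCoercive_formL hα) (formL_comm α) triL triL_self_right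
      (forcing g) γ hu hφ.hasDerivAt_curve hφ.timeDeriv.continuous_curve ht
    rw [distSq_eq, distSq_eq]
    simp only [growthRate_eq_rate α hφ]
    refine h.trans (le_of_eq ?_)
    congr 2
    refine intervalIntegral.integral_congr fun τ _ => ?_
    rw [← inner_residual hα γ g hφ τ]
    rfl

/-- The inequality for a test field is exactly the abstract `energyBound`, and coercivity turns
local boundedness of the energy into a bound in `H`. -/
theorem IsDissipativeSolution.eqOn {u v : ℝ → H}
    (hu : ∀ t, 0 ≤ t → HasDerivWithinAt u (bardinaField hα γ g (u t)) (Ici 0) t)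
    (hv : IsDissipativeSolution α γ g (u 0) v) : EqOn v u (Ici 0) := by
  intro t ht
  obtain ⟨C, hC⟩ := hv.locallyBounded t
  have hm : 0 < min 1 α := lt_min one_pos hα
  have hbound : ∀ s ∈ Icc 0 t, ‖v s‖ ≤ Real.sqrt (C / min 1 α) := fun s hs => by
    refine Real.le_sqrt_of_sq_le ?_
    rw [le_div_iff₀ hm, mul_comm]
    refine (min_mul_sq_le_formL α (v s)).trans ?_
    rw [formL_self]
    exact hC s hs
  refine eq_of_energy_inequality (isCoercive_formL hα) triL (forcing g) γ dense_smoothH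
    isTestClass_isTestCurve hu ht hbound hv.initial ?_
  rintro _ _ ⟨φ, hφ, rfl, rfl⟩
  have h := hv.inequality φ hφ t ht
  rw [distSq_eq, distSq_eq] at h
  simp only [growthRate_eq_rate α hφ] at h
  refine h.trans (le_of_eq ?_)
  rw [energyBound]
  congr 2
  refine intervalIntegral.integral_congr fun τ _ => ?_
  rw [← inner_residual hα γ g hφ τ]
  rfl

end Solutions

end BardinaEuler

end

theorem mainTheorem6 (α γ : ℝ) (hα : 0 < α) (hγ : 0 < γ)
    (g : BardinaEuler.L2) (u₀ : BardinaEuler.H) :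
    ∃ u : ℝ → BardinaEuler.H,
      BardinaEuler.IsStrongSolution α γ g u₀ u ∧
      (∀ w : ℝ → BardinaEuler.H,
        BardinaEuler.IsStrongSolution α γ g u₀ w → Set.EqOn w u (Set.Ici 0)) ∧
      BardinaEuler.IsDissipativeSolution α γ g u₀ u ∧
      (∀ v : ℝ → BardinaEuler.H,
        BardinaEuler.IsDissipativeSolution α γ g u₀ v → Set.EqOn v u (Set.Ici 0)) := by
  obtain ⟨u, rfl, hu⟩ := BardinaEuler.exists_solution (BardinaEuler.isCoercive_formL hα)
    (BardinaEuler.formL_comm α) BardinaEuler.triL BardinaEuler.triL_self_right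
    (BardinaEuler.forcing g) hγ u₀
  refine ⟨u, BardinaEuler.isStrongSolution_of_hasDerivWithinAt hα γ g hu, fun w hw => ?_,
    BardinaEuler.isDissipativeSolution_of_hasDerivWithinAt hα γ g hu,
    fun v hv => hv.eqOn hα γ g hu⟩
  exact BardinaEuler.solution_unique (BardinaEuler.isCoercive_formL hα) BardinaEuler.triL
    (BardinaEuler.forcing g) (hw.hasDerivWithinAt hα γ g) hu hw.initial
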